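/- **Notation.** For a monic polynomial $p$ of degree $d$ with real coefficients write $p(x)=\sum_{k=0}^d(-1)^k\binom dk \tilde e_k(p)\,x^{d-k}$, let $m_n(p)=\frac1d\sum_{i=1}^d\lambda_i^n$, where $\lambda_1,\dots,\lambda_d$ are its complex roots with multiplicity, and let $p\boxtimes_d q$ be the polynomial with $\tilde e_k(p\boxtimes_d q)=\tilde e_k(p)\tilde e_k(q)$ for $0\le k\le d$. The finite free cumulants of $p$ are, for $1\le n\le d$, $$\kappa_n(p)=\frac{(-d)^{n-1}}{(n-1)!}\sum_{\pi\in P(n)}(-1)^{|\pi|-1}(|\pi|-1)!\prod_{V\in\pi}\tilde e_{|V|}(p),$$ where $P(n)$ is the set of all partitions of $[n]=\{1,\dots,n\}$. For a sequence $u=(u_n)_{n\ge1}$ put $u_\pi=\prod_{V\in\pi}u_{|V|}$ for a partition $\pi$, let $u_{\pi\setminus V}$ be the same product over the blocks other than $V$, and put $u_\sigma=\prod_{c}u_{|c|}$ over all cycles $c$ (fixed points included) of a permutation $\sigma$. Let $NC(n)$ be the set of non-crossing partitions of $[n]$, and let $Kr(\pi)=\pi^{-1}\gamma_n$, $\gamma_n=(1,\dots,n)$,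 be the Kreweras complement, where partitions are read as permutations whose cycles are the blocks in increasing order, and conversely. For $t,s\ge1$ let $\gamma_{t,s}=(1,\dots,t)(t+1,\dots,t+s)$, let $S_{NC}(t,s)$ be the set of $\sigma\in S_{t+s}$ such that $\langle\sigma,\gamma_{t,s}\rangle$ is transitive and $\sigma$ and $Kr_{t,s}(\sigma):=\sigma^{-1}\gamma_{t,s}$ together have $t+s$ cycles. For a probability measure $\mu$ on $\mathbb R$ with finite moments $m_n(\mu)$ of all orders, the free cumulants $r_n(\mu)$ are defined by $m_n(\mu)=\sum_{\pi\in NC(n)}r_\pi(\mu)$, $n\ge1$. The free multiplicative convolution $\mu\boxtimes\nu$ is given by its free cumulants $r_n(\mu\boxtimes\nu)=\sum_{\pi\in NC(n)}r_\pi(\mu)\,r_{Kr(\pi)}(\nu)$, and $m_n(\mu\boxtimes\nu)=\sum_{\pi\in NC(n)}r_\pi(\mu\boxtimes\nu)$; these are the moments of any probability measure with finite moments of all orders and with these free cumulants. A sequence $\mathfrak p=(p_d)_{d\ge1}$ of monic real-rooted polynomials, $\deg p_d=d$, has infinitesimal distribution $(\mu,\mu')$, where $\mu$ is a probability measure on $\mathbb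 R$ with finite moments of all orders and $\mu':\mathbb R[x]\to\mathbb R$ is linear, if for all $n\ge0$ one has $m_n(p_d)\to m_n(\mu)$ and $d\,(m_n(p_d)-m_n(\mu))\to\mu'(x^n)=:m_n'(\mathfrak p)$ as $d\to\infty$. **Theorem.** Let $\mathfrak p=(p_d)_{d\ge1}$ and $\mathfrak q=(q_d)_{d\ge1}$ be sequences of monic real-rooted polynomials, $\deg p_d=\deg q_d=d$, with infinitesimal distributions $(\mu,\mu')$ and $(\nu,\nu')$, respectively. Then there are numbers $\hat r_n(\mathfrak q)$, $n\ge1$, not depending on $d$, with $\kappa_n(q_d)=r_n(\nu)+\frac1d\hat r_n(\mathfrak q)+o(1/d)$ for every $n\ge1$, and for every $n\ge1$ $$m_n(p_d\boxtimes_d q_d)=m_n(\mu\boxtimes\nu)+\frac1d\,m_n'(\mathfrak p\boxtimes\mathfrak q)+o(1/d)\qquad(d\to\infty),$$ where $$m'_n(\mathfrak p\boxtimes\mathfrak q)=\sum_{\pi\in NC(n)}\Big(\sum_{V\in\pi}m'_{|V|}(\mathfrak p)\,m_{\pi\setminus V}(\mu)\,r_{Kr(\pi)}(\nu)+\sum_{W\in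 Kr(\pi)}m_\pi(\mu)\,\hat r_{|W|}(\mathfrak q)\,r_{Kr(\pi)\setminus W}(\nu)\Big)-\frac n2\sum_{\substack{t+s=n,\ t,s\ge1\\ \sigma\in S_{NC}(t,s)}}\frac{m_\sigma(\mu)\,r_{Kr_{t,s}(\sigma)}(\nu)}{ts}.$$ -/

import Mathlib

open Finset Polynomial Filter MeasureTheory Topology Asymptotics

namespace FiniteFree

/-! ### Set partitions and permutations -/

/-- `SetPartition n` is the set `P(n)` of all partitions of an `n`-element set, modelled on `Fin n`
with its usual order. -/
abbrev SetPartition (n : ℕ) : Type := Finpartition (univ : Finset (Fin n))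

/-- `u_π = ∏_{V ∈ π} u_{|V|}`. -/
def blockProd {n : ℕ} (u : ℕ → ℝ) (π : SetPartition n) : ℝ :=
  ∏ V ∈ π.parts, u #V

/-- `∑_{V ∈ π} a_{|V|} u_{π ∖ V}`, where `u_{π ∖ V}` is the product over the blocks of `π` other
than `V`. -/
def blockDerivSum {n : ℕ} (a u : ℕ → ℝ) (π : SetPartition n) : ℝ :=
  ∑ V ∈ π.parts, a #V * ∏ W ∈ π.parts.erase V, u #W

/-- `π` is non-crossing: if `a < b < c < d` with `a, c ∈ V` and `b, d ∈ W` for blocks `V`, `W`,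
then `V = W`. -/
def IsNonCrossing {n : ℕ} (π : SetPartition n) : Prop :=
  ∀ V ∈ π.parts, ∀ W ∈ π.parts, ∀ a ∈ V, ∀ b ∈ W, ∀ c ∈ V, ∀ d ∈ W,
    a < b → b < c → c < d → V = W

instance {n : ℕ} (π : SetPartition n) : Decidable (IsNonCrossing π) := by
  unfold IsNonCrossing; infer_instance

/-- The set `NC(n)` of non-crossing partitions. -/
def NC (n : ℕ) : Finset (SetPartition n) := univ.filter IsNonCrossing

/-- The partition whose blocks are the cycles (fixed points included) of a permutation. -/
def cyclePartition {n : ℕ} (σ : Equiv.Perm (Fin n)) : SetPartition n :=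
  letI : DecidableRel (Equiv.Perm.SameCycle.setoid σ).r :=
    inferInstanceAs (DecidableRel (Equiv.Perm.SameCycle σ))
  Finpartition.ofSetoid (Equiv.Perm.SameCycle.setoid σ)

/-- The cyclic permutation that runs through the elements of `V` in increasing order and fixes
everything else. -/
def blockCycle {n : ℕ} (V : Finset (Fin n)) : Equiv.Perm (Fin n) :=
  (V.sort (· ≤ ·)).formPerm

theorem blockCycle_apply_of_notMem {n : ℕ} {V : Finset (Fin n)} {i : Fin n} (h : i ∉ V) :
    blockCycle V i = i :=
  List.formPerm_apply_of_notMem (by simpa using h)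

theorem blockCycle_pairwise_commute {n : ℕ} (π : SetPartition n) :
    (π.parts : Set (Finset (Fin n))).Pairwise (Function.onFun Commute blockCycle) := by
  intro V hV W hW hVW
  refine Equiv.Perm.Disjoint.commute fun i => ?_
  by_cases hi : i ∈ V
  · exact Or.inr (blockCycle_apply_of_notMem
      (Finset.disjoint_left.mp (π.disjoint hV hW hVW) hi))
  · exact Or.inl (blockCycle_apply_of_notMem hi)

/-- A partition seen as a permutation: its cycles are the blocks written in increasing order. -/
def partitionPerm {n : ℕ} (π : SetPartition n) : Equiv.Perm (Fin n) :=
  π.parts.noncommProd blockCycle (blockCycle_pairwise_commute π)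

/-- The Kreweras complement `Kr(π) = π⁻¹ γ_n`, seen as a partition, with `γ_n = (1, 2, …, n)`. -/
def kreweras {n : ℕ} (π : SetPartition n) : SetPartition n :=
  cyclePartition ((partitionPerm π)⁻¹ * finRotate n)

/-- `γ_{t,s} = (1, …, t)(t+1, …, t+s)`. -/
def annularRotate (t s : ℕ) : Equiv.Perm (Fin (t + s)) :=
  finSumFinEquiv.permCongr (Equiv.sumCongr (finRotate t) (finRotate s))

/-- The annular Kreweras complement `Kr_{t,s}(σ) = σ⁻¹ γ_{t,s}`. -/
def annularKreweras {t s : ℕ} (σ : Equiv.Perm (Fin (t + s))) : Equiv.Perm (Fin (t + s)) :=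
  σ⁻¹ * annularRotate t s

open Classical in
/-- The set `S_NC(t,s)` of annular non-crossing permutations: `σ` and `γ_{t,s}` generate a
transitive group, and `σ` and `σ⁻¹ γ_{t,s}` together have `t + s` cycles. -/
noncomputable def annularNC (t s : ℕ) : Finset (Equiv.Perm (Fin (t + s))) :=
  univ.filter fun σ =>
    MulAction.IsPretransitive (Subgroup.closure {σ, annularRotate t s}) (Fin (t + s)) ∧
    #(cyclePartition σ).parts + #(cyclePartition (annularKreweras σ)).parts = t + s

/-! ### Free cumulants and free multiplicative convolution -/

/-- The `n`-th moment `m_n(μ)`. -/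
noncomputable def moment (μ : Measure ℝ) (n : ℕ) : ℝ := ∫ x, x ^ n ∂μ

/-- `m_n = ∑_{π ∈ NC(n)} r_π`. -/
def momentOfCumulant (r : ℕ → ℝ) (n : ℕ) : ℝ := ∑ π ∈ NC n, blockProd r π

/-- The free cumulants of a sequence `m` of moments, defined by solving the moment-cumulant formula
`m_n = ∑_{π ∈ NC(n)} r_π` recursively for the term `r_n` with `π = 1_n`
(see `moment_cumulant_formula`). The test `#V < n` always succeeds there. -/
def cumulantOfMoment (m : ℕ → ℝ) (n : ℕ) : ℝ :=
  m n - ∑ π ∈ (NC n).erase ⊤, ∏ V ∈ π.parts, if #V < n then cumulantOfMoment m #V else 0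
  termination_by n

theorem top_parts {n : ℕ} (hn : 1 ≤ n) : (⊤ : SetPartition n).parts = {univ} := by
  have : NeZero n := ⟨by omega⟩
  have h : (univ : Finset (Fin n)) ≠ ⊥ := (Finset.univ_nonempty).ne_empty
  refine (Finpartition.parts_top_subset _).antisymm ?_
  have hne : (⊤ : SetPartition n).parts ≠ ∅ := fun h0 => by
    have := (⊤ : SetPartition n).sup_parts
    rw [h0] at this
    exact h this.symm
  exact (Finset.subset_singleton_iff.mp (Finpartition.parts_top_subset _)).resolve_left hne |>.ge

theorem card_block_lt {n : ℕ} {π : SetPartition n} (hπ : π ≠ ⊤) {V : Finset (Fin n)}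
    (hV : V ∈ π.parts) : #V < n := by
  have hne : V ≠ univ := by
    rintro rfl
    apply hπ
    refine top_le_iff.mp fun W _ => ⟨univ, hV, Finset.subset_univ W⟩
  simpa using Finset.card_lt_card (Finset.ssubset_univ_iff.mpr hne)

theorem top_mem_NC {n : ℕ} (hn : 1 ≤ n) : (⊤ : SetPartition n) ∈ NC n := by
  simp only [NC, Finset.mem_filter, Finset.mem_univ, true_and, IsNonCrossing, top_parts hn,
    Finset.mem_singleton]
  intro V hV W hW
  simp [hV, hW]

/-- The moment-cumulant formula. -/
theorem moment_cumulant_formula (m : ℕ → ℝ) {n : ℕ} (hn : 1 ≤ n) :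
    m n = ∑ π ∈ NC n, blockProd (cumulantOfMoment m) π := by
  rw [← Finset.add_sum_erase _ _ (top_mem_NC hn)]
  have h1 : blockProd (cumulantOfMoment m) (⊤ : SetPartition n) = cumulantOfMoment m n := by
    simp [blockProd, top_parts hn]
  have h2 : ∑ π ∈ (NC n).erase ⊤, blockProd (cumulantOfMoment m) π =
      ∑ π ∈ (NC n).erase ⊤, ∏ V ∈ π.parts, if #V < n then cumulantOfMoment m #V else 0 := by
    refine Finset.sum_congr rfl fun π hπ => Finset.prod_congr rfl fun V hV => ?_
    rw [if_pos (card_block_lt (Finset.ne_of_mem_erase hπ) hV)]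
  have h3 : cumulantOfMoment m n = m n - ∑ π ∈ (NC n).erase ⊤, ∏ V ∈ π.parts,
      if #V < n then cumulantOfMoment m #V else 0 := by
    rw [cumulantOfMoment]
  rw [h1, h2, h3]
  ring

/-- The free cumulants `r_n(μ)`. -/
noncomputable def freeCumulant (μ : Measure ℝ) : ℕ → ℝ := cumulantOfMoment (moment μ)

/-- The free cumulants of `μ ⊠ ν`: `r_n(μ ⊠ ν) = ∑_{π ∈ NC(n)} r_π(μ) r_{Kr(π)}(ν)`. -/
noncomputable def freeMulCumulant (μ ν : Measure ℝ) (n : ℕ) : ℝ :=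
  ∑ π ∈ NC n, blockProd (freeCumulant μ) π * blockProd (freeCumulant ν) (kreweras π)

/-- The moments `m_n(μ ⊠ ν)`, computed from the free cumulants of `μ ⊠ ν`. -/
noncomputable def freeMulMoment (μ ν : Measure ℝ) : ℕ → ℝ :=
  momentOfCumulant (freeMulCumulant μ ν)

/-- `ρ` has finite moments of all orders. -/
def HasAllMoments (ρ : Measure ℝ) : Prop := ∀ n : ℕ, Integrable (fun x : ℝ => x ^ n) ρ

/-- The probability measure `ρ` is the free multiplicative convolution of `μ` and `ν`. -/
structure IsFreeMulConv (μ ν ρ : Measure ℝ) : Prop where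
  isProbabilityMeasure : IsProbabilityMeasure ρ
  hasAllMoments : HasAllMoments ρ
  freeCumulant_eq : ∀ n : ℕ, 1 ≤ n → freeCumulant ρ n = freeMulCumulant μ ν n

/-! ### Polynomials -/

/-- The set of monic real-rooted polynomials of degree `d`. -/
def MonicRealRooted (d : ℕ) : Set ℝ[X] := {p | p.Monic ∧ p.natDegree = d ∧ p.Splits}

/-- The normalized coefficients `e_k(p)` of a polynomial
`p = ∑_{k=0}^d (-1)^k (d choose k) e_k(p) x^{d-k}` (for `k ≤ d`). -/
noncomputable def normCoeff (d : ℕ) (p : ℝ[X]) (k : ℕ) : ℝ :=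
  (-1) ^ k * p.coeff (d - k) / (d.choose k : ℝ)

/-- The finite free multiplicative convolution `p ⊠_d q`. -/
noncomputable def finiteFreeMul (d : ℕ) (p q : ℝ[X]) : ℝ[X] :=
  ∑ k ∈ range (d + 1),
    C ((-1) ^ k * (d.choose k : ℝ) * (normCoeff d p k * normCoeff d q k)) * X ^ (d - k)

/-- The `n`-th moment `m_n(p) = (1/d) ∑ λ^n` of the root distribution of a polynomial of degree `d`,
the sum being over the complex roots with multiplicity. The sum is real
(`sum_aroots_pow_im`), and if `p` is real-rooted it is the sum over the real roots
(`rootMoment_of_splits`). -/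
noncomputable def rootMoment (d : ℕ) (p : ℝ[X]) (n : ℕ) : ℝ :=
  ((p.aroots ℂ).map (fun z => z ^ n)).sum.re / d

theorem sum_aroots_pow_im (p : ℝ[X]) (n : ℕ) : ((p.aroots ℂ).map (fun z => z ^ n)).sum.im = 0 := by
  have h1 : (p.aroots ℂ).map (starRingEnd ℂ) = p.aroots ℂ := by
    have h := (IsAlgClosed.splits (p.map (algebraMap ℝ ℂ))).roots_map (starRingEnd ℂ)
    have h2 : (starRingEnd ℂ).comp (algebraMap ℝ ℂ) = algebraMap ℝ ℂ := by
      ext x; simp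
    rw [Polynomial.map_map, h2] at h
    exact h.symm
  rw [← Complex.conj_eq_iff_im, map_multiset_sum, Multiset.map_map]
  conv_rhs => rw [← h1, Multiset.map_map]
  simp

theorem rootMoment_of_splits (d : ℕ) {p : ℝ[X]} (hp : p.Splits) (n : ℕ) :
    rootMoment d p n = (p.roots.map (fun x => x ^ n)).sum / d := by
  have h : p.aroots ℂ = p.roots.map (algebraMap ℝ ℂ) :=
    hp.roots_map (algebraMap ℝ ℂ)
  have h2 : ((p.aroots ℂ).map (fun z => z ^ n)).sum =
      (((p.roots.map (fun x => x ^ n)).sum : ℝ) : ℂ) := by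
    rw [h, Multiset.map_map]
    change _ = Complex.ofRealHom _
    rw [map_multiset_sum, Multiset.map_map]
    simp
  rw [rootMoment, h2, Complex.ofReal_re]

/-- The finite free cumulants
`κ_n(p) = (-d)^{n-1}/(n-1)! ∑_{π ∈ P(n)} (-1)^{|π|-1} (|π|-1)! ∏_{V ∈ π} e_{|V|}(p)`,
for `1 ≤ n ≤ d`. -/
noncomputable def finiteFreeCumulant (d : ℕ) (p : ℝ[X]) (n : ℕ) : ℝ :=
  (-(d : ℝ)) ^ (n - 1) / ((n - 1).factorial : ℝ) *
    ∑ π : SetPartition n, (-1) ^ (#π.parts - 1) * ((#π.parts - 1).factorial : ℝ) *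
      blockProd (normCoeff d p) π

/-- The sequence `(p_d)_{d ≥ 1}` has infinitesimal distribution `(μ, μ')`: its root distributions
converge in moments to the probability measure `μ`, and for every `n` the limit
`m_n'(𝔭) = lim_d d (m_n(p_d) - m_n(μ))` exists and equals `μ'(x^n)`. -/
structure HasInfinitesimalDistribution (p : ℕ → ℝ[X]) (μ : Measure ℝ) (μ' : ℝ[X] →ₗ[ℝ] ℝ) :
    Prop where
  isProbabilityMeasure : IsProbabilityMeasure μ
  hasAllMoments : HasAllMoments μ
  tendsto_moment : ∀ n : ℕ,
    Tendsto (fun d : ℕ => rootMoment d (p d) n) atTop (𝓝 (moment μ n))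
  tendsto_infinitesimal : ∀ n : ℕ,
    Tendsto (fun d : ℕ => (d : ℝ) * (rootMoment d (p d) n - moment μ n)) atTop (𝓝 (μ' (X ^ n)))

/-- `r̂` is the sequence of cumulant fluctuations of `(q_d)_{d ≥ 1}` (with limiting root
distribution `ν`): `κ_n(q_d) = r_n(ν) + r̂_n / d + o(1/d)` for all `n ≥ 1`. -/
def IsCumulantFluctuation (q : ℕ → ℝ[X]) (ν : Measure ℝ) (rhat : ℕ → ℝ) : Prop :=
  ∀ n : ℕ, 1 ≤ n →
    (fun d : ℕ => finiteFreeCumulant d (q d) n - (freeCumulant ν n + rhat n / d))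
      =o[atTop] (fun d : ℕ => 1 / (d : ℝ))

/-- `∑_{π ∈ NC(n)} (∑_{V ∈ π} m'_{|V|} m_{π∖V} r_{Kr(π)} + ∑_{W ∈ Kr(π)} m_π r̂_{|W|} r_{Kr(π)∖W})
  - (n/2) ∑_{t+s=n, σ ∈ S_NC(t,s)} m_σ r_{Kr_{t,s}(σ)} / (ts)`, where `t, s ≥ 1`. -/
noncomputable def mulInfinitesimalMoment (m m' r rhat : ℕ → ℝ) (n : ℕ) : ℝ :=
  ∑ π ∈ NC n,
      (blockDerivSum m' m π * blockProd r (kreweras π) +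
        blockProd m π * blockDerivSum rhat r (kreweras π)) -
    (n : ℝ) / 2 *
      ∑ ts ∈ (antidiagonal n).filter (fun ts => 1 ≤ ts.1 ∧ 1 ≤ ts.2),
        ∑ σ ∈ annularNC ts.1 ts.2,
          blockProd m (cyclePartition σ) * blockProd r (cyclePartition (annularKreweras σ)) /
            ((ts.1 : ℝ) * (ts.2 : ℝ))

end FiniteFree

/-!
The coefficients of a monic polynomial of degree `d` are sums over permutations, weighted either by
its power sums or by its finite free cumulants, so the coefficients of `p ⊠_d q` are sums over pairs
`(α, β)` of permutations. Passing to cumulants keeps the pairs that generate a transitive group: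
with `#` the number of cycles, both `κ_n(p ⊠_d q)` (for `u = κ(p)`) and `m_n(p ⊠_d q)` (for
`u = m(p)`) are equal to
`1/(n-1)! ∑_{(α, β) transitive} (-1/d)^(n + 1 - #α - #β) u_α κ_β(q)`.

By the genus inequality `#α + #β + #(α * β) ≤ n + 2` the exponent is nonnegative. It vanishes only
if `α * β` is a long cycle and `α` is non-crossing, with Kreweras complement `β`. If it is `1`, then
`α * β` has two cycles (a long cycle is excluded by parity), and `α` is an annular non-crossing
permutation. These two families give the orders `1` and `1/d`.

For `p = (x - 1)^d` the formula expresses the moments of `q` through its cumulants, triangularly,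
and this yields the expansion of the cumulants by induction.
-/

namespace FiniteFree

/-! ### Cycles of permutations and the genus inequality -/

section Cycles

variable {X Y : Type*}

/-- The equivalence relation whose classes are the cycles (fixed points included) of `σ`. Joins of
such relations describe the orbits of the group generated by several permutations. -/
abbrev cycleRel (σ : Equiv.Perm X) : Setoid X := Equiv.Perm.SameCycle.setoid σ

/-- The number of classes of an equivalence relation; `numClasses (cycleRel σ)` is the number of
cycles of `σ`. It is meaningful when there are finitely many classes. -/
noncomputable def numClasses (r : Setoid X) : ℕ := Nat.card (Quotient r)

theorem cycleRel_apply (σ : Equiv.Perm X) (x : X) : cycleRel σ x (σ x) :=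
  Equiv.Perm.sameCycle_apply_right.mpr Equiv.Perm.SameCycle.rfl

theorem cycleRel_le_iff {σ : Equiv.Perm X} {s : Setoid X} :
    cycleRel σ ≤ s ↔ ∀ x, s x (σ x) := by
  refine ⟨fun h x => h (cycleRel_apply σ x), fun h x y hxy => ?_⟩
  obtain ⟨k, rfl⟩ := hxy
  induction k using Int.induction_on with
  | zero => exact s.refl x
  | succ k ih =>
    rw [add_comm, zpow_add, zpow_one, Equiv.Perm.mul_apply]
    exact s.trans ih (h _)
  | pred k ih =>
    refine s.trans ih (s.symm ?_)
    have := h ((σ ^ (-(k : ℤ) - 1)) x)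
    rwa [← Equiv.Perm.mul_apply, ← zpow_one_add, add_sub_cancel] at this

theorem cycleRel_one : cycleRel (1 : Equiv.Perm X) = ⊥ :=
  le_bot_iff.mp (cycleRel_le_iff.mpr fun _ => rfl)

theorem cycleRel_inv (σ : Equiv.Perm X) : cycleRel σ⁻¹ = cycleRel σ :=
  Setoid.ext fun _ _ => Equiv.Perm.sameCycle_inv

theorem cycleRel_mul_le {α β : Equiv.Perm X} {s : Setoid X} (hα : cycleRel α ≤ s)
    (hβ : cycleRel β ≤ s) : cycleRel (α * β) ≤ s :=
  cycleRel_le_iff.mpr fun x =>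
    s.trans (cycleRel_le_iff.mp hβ x) (cycleRel_le_iff.mp hα (β x))

theorem cycleRel_mul_sup_right (α β : Equiv.Perm X) :
    cycleRel (α * β) ⊔ cycleRel β = cycleRel α ⊔ cycleRel β := by
  refine le_antisymm (sup_le (cycleRel_mul_le le_sup_left le_sup_right) le_sup_right)
    (sup_le ?_ le_sup_right)
  have h : cycleRel (α * β * β⁻¹) ≤ cycleRel (α * β) ⊔ cycleRel β :=
    cycleRel_mul_le le_sup_left ((cycleRel_inv β).le.trans le_sup_right)
  rwa [mul_inv_cancel_right] at h

theorem cycleRel_sup_mul_left (α β : Equiv.Perm X) :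
    cycleRel α ⊔ cycleRel (α * β) = cycleRel α ⊔ cycleRel β := by
  refine le_antisymm (sup_le le_sup_left (cycleRel_mul_le le_sup_left le_sup_right))
    (sup_le le_sup_left ?_)
  have h : cycleRel (α⁻¹ * (α * β)) ≤ cycleRel α ⊔ cycleRel (α * β) :=
    cycleRel_mul_le ((cycleRel_inv α).le.trans le_sup_left) le_sup_right
  rwa [inv_mul_cancel_left] at h

theorem cycleRel_swap_le_iff [DecidableEq X] {i j : X} {s : Setoid X} :
    cycleRel (Equiv.swap i j) ≤ s ↔ s i j := by
  rw [cycleRel_le_iff]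
  refine ⟨fun h => by simpa using h i, fun h x => ?_⟩
  rcases eq_or_ne x i with rfl | hi
  · simpa using h
  rcases eq_or_ne x j with rfl | hj
  · simpa using s.symm h
  · rw [Equiv.swap_apply_of_ne_of_ne hi hj]

theorem sup_cycleRel_swap_of_rel [DecidableEq X] {r : Setoid X} {i j : X} (h : r i j) :
    r ⊔ cycleRel (Equiv.swap i j) = r :=
  sup_eq_left.mpr (cycleRel_swap_le_iff.mpr h)

theorem cycleRel_permCongr (e : X ≃ Y) (σ : Equiv.Perm X) {x y : X} :
    cycleRel (e.permCongr σ) (e x) (e y) ↔ cycleRel σ x y := by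
  refine ⟨fun h => ?_, fun h => ?_⟩
  · have hle : cycleRel (e.permCongr σ) ≤ Setoid.comap e.symm (cycleRel σ) :=
      cycleRel_le_iff.mpr fun z => by
        simpa [Setoid.comap_rel] using cycleRel_apply σ (e.symm z)
    simpa [Setoid.comap_rel] using hle h
  · have hle : cycleRel σ ≤ Setoid.comap e (cycleRel (e.permCongr σ)) :=
      cycleRel_le_iff.mpr fun z => by
        simpa [Setoid.comap_rel] using cycleRel_apply (e.permCongr σ) (e z)
    exact hle h

theorem numClasses_bot : numClasses (⊥ : Setoid X) = Nat.card X :=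
  Nat.card_congr Setoid.quotientBotEquiv

theorem numClasses_top [Nonempty X] : numClasses (⊤ : Setoid X) = 1 := by
  rw [numClasses, Nat.card_eq_one_iff_unique]
  exact ⟨⟨Quotient.ind₂ fun _ _ => Quotient.sound trivial⟩,
    ⟨Quotient.mk ⊤ (Classical.arbitrary X)⟩⟩

theorem numClasses_ker (f : X → Y) : numClasses (Setoid.ker f) = (Set.range f).ncard :=
  Nat.card_congr (Setoid.quotientKerEquivRange f)

variable [Finite X]

theorem numClasses_anti {r s : Setoid X} (h : r ≤ s) : numClasses s ≤ numClasses r :=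
  Nat.card_le_card_of_surjective (Quotient.map' id h) (Quotient.ind fun x => ⟨⟦x⟧, rfl⟩)

theorem eq_of_numClasses_le {r s : Setoid X} (h : r ≤ s) (hc : numClasses r ≤ numClasses s) :
    r = s := by
  have hsurj : Function.Surjective (Quotient.map' id h : Quotient r → Quotient s) :=
    Quotient.ind fun x => ⟨⟦x⟧, rfl⟩
  have hbij := hsurj.bijective_of_nat_card_le hc
  exact le_antisymm h fun x y hxy =>
    Quotient.exact (hbij.injective (a₁ := ⟦x⟧) (a₂ := ⟦y⟧) (Quotient.sound hxy))

theorem numClasses_pos [Nonempty X] (r : Setoid X) : 0 < numClasses r :=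
  numClasses_top.symm.le.trans (numClasses_anti le_top)

theorem numClasses_eq_one_iff [Nonempty X] {r : Setoid X} : numClasses r = 1 ↔ r = ⊤ :=
  ⟨fun h => eq_of_numClasses_le le_top (by rw [h, numClasses_top]),
    fun h => h ▸ numClasses_top⟩

theorem numClasses_le_card (r : Setoid X) : numClasses r ≤ Nat.card X :=
  numClasses_bot (X := X) ▸ numClasses_anti bot_le

theorem numClasses_le_sup_swap [DecidableEq X] (r : Setoid X) (i j : X) :
    numClasses r ≤ numClasses (r ⊔ cycleRel (Equiv.swap i j)) + 1 := by
  classical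
  let merge : X → Quotient r := fun x =>
    if (⟦x⟧ : Quotient r) = ⟦j⟧ then ⟦i⟧ else ⟦x⟧
  have hker : r ⊔ cycleRel (Equiv.swap i j) ≤ Setoid.ker merge := by
    refine sup_le (fun x y hxy => ?_) (cycleRel_swap_le_iff.mpr ?_)
    · simp only [Setoid.ker_def, merge, (Quotient.sound hxy : (⟦x⟧ : Quotient r) = ⟦y⟧)]
    · simp only [Setoid.ker_def, merge]
      split_ifs <;> rfl
  have hrange : insert ⟦j⟧ (Set.range merge) = Set.univ :=
    Set.eq_univ_of_forall <| Quotient.ind fun x => by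
      by_cases hx : (⟦x⟧ : Quotient r) = ⟦j⟧
      · exact Or.inl hx
      · exact Or.inr ⟨x, if_neg hx⟩
  calc numClasses r = (insert ⟦j⟧ (Set.range merge)).ncard := by
        rw [hrange, Set.ncard_univ, numClasses]
    _ ≤ (Set.range merge).ncard + 1 := Set.ncard_insert_le _ _
    _ = numClasses (Setoid.ker merge) + 1 := by rw [numClasses_ker]
    _ ≤ numClasses (r ⊔ cycleRel (Equiv.swap i j)) + 1 :=
        Nat.add_le_add_right (numClasses_anti hker) 1

theorem numClasses_sup_swap_of_not_rel [DecidableEq X] {r : Setoid X} {i j : X} (h : ¬ r i j) :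
    numClasses (r ⊔ cycleRel (Equiv.swap i j)) + 1 = numClasses r := by
  refine le_antisymm ?_ (numClasses_le_sup_swap r i j)
  by_contra! hlt
  have hr := eq_of_numClasses_le (le_sup_left : r ≤ r ⊔ cycleRel (Equiv.swap i j)) (by omega)
  exact h (by rw [hr]; exact cycleRel_swap_le_iff.mp le_sup_right)

theorem mem_iff_of_sameCycle {σ : Equiv.Perm X} {A : Set X} (hA : Set.MapsTo σ A A) {x y : X}
    (h : σ.SameCycle x y) : x ∈ A ↔ y ∈ A := by
  have mem_of_mem : ∀ {x y}, σ.SameCycle x y → x ∈ A → y ∈ A := fun {x y} hxy hx => by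
    obtain ⟨k, rfl⟩ := hxy.exists_nat_pow_eq
    rw [← Equiv.Perm.iterate_eq_pow]
    exact hA.iterate k hx
  exact ⟨mem_of_mem h, mem_of_mem h.symm⟩

section Swap

variable [DecidableEq X] {σ : Equiv.Perm X} {i j : X}

theorem sameCycle_mul_swap_of_not_sameCycle (h : ¬ σ.SameCycle i j) :
    (σ * Equiv.swap i j).SameCycle i j := by
  by_contra hn
  let A : Set X := {x | σ.SameCycle i x ∧ (σ * Equiv.swap i j).SameCycle j x}
  have hA : Set.MapsTo σ A A := by
    rintro x ⟨hix, hjx⟩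
    have hxi : x ≠ i := by rintro rfl; exact hn hjx.symm
    have hxj : x ≠ j := by rintro rfl; exact h hix
    refine ⟨Equiv.Perm.sameCycle_apply_right.mpr hix, ?_⟩
    have := Equiv.Perm.sameCycle_apply_right.mpr hjx
    rwa [Equiv.Perm.mul_apply, Equiv.swap_apply_of_ne_of_ne hxi hxj] at this
  have hσi : σ i ∈ A := by
    refine ⟨cycleRel_apply σ i, ?_⟩
    have := cycleRel_apply (σ * Equiv.swap i j) j
    rwa [Equiv.Perm.mul_apply, Equiv.swap_apply_right] at this
  exact hn ((mem_iff_of_sameCycle hA (cycleRel_apply σ i)).mpr hσi).2.symm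

theorem not_sameCycle_mul_swap (hij : i ≠ j) (h : σ.SameCycle i j) :
    ¬ (σ * Equiv.swap i j).SameCycle i j := by
  classical
  have hex : ∃ a : ℕ, (σ ^ a) i = j := h.exists_nat_pow_eq
  obtain ⟨a, ha, hmin⟩ : ∃ a : ℕ, (σ ^ a) i = j ∧ ∀ b < a, (σ ^ b) i ≠ j :=
    ⟨Nat.find hex, Nat.find_spec hex, fun b hb => Nat.find_min hex hb⟩
  have ha0 : 1 ≤ a := Nat.one_le_iff_ne_zero.mpr fun h0 => hij (by simpa [h0] using ha)
  -- The arc of the cycle of `σ` that starts after `i` and ends in `j` is closed under `σ * (i j)`.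
  let arc : Set X := {x | ∃ k, 1 ≤ k ∧ k ≤ a ∧ (σ ^ k) i = x}
  have hi : i ∉ arc := by
    rintro ⟨k, hk, hka, hki⟩
    refine hmin (a - k) (by omega) ?_
    rw [← ha]
    conv_rhs => rw [← Nat.sub_add_cancel hka, pow_add, Equiv.Perm.mul_apply, hki]
  have harc : Set.MapsTo (σ * Equiv.swap i j) arc arc := by
    rintro x ⟨k, hk, hka, rfl⟩
    rw [Equiv.Perm.mul_apply]
    rcases hka.eq_or_lt with rfl | hlt
    · rw [ha, Equiv.swap_apply_right]
      exact ⟨1, le_rfl, ha0, by rw [pow_one]⟩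
    · rw [Equiv.swap_apply_of_ne_of_ne (fun e => hi ⟨k, hk, hka, e⟩) (hmin k hlt)]
      exact ⟨k + 1, by omega, hlt, by rw [pow_succ', Equiv.Perm.mul_apply]⟩
  exact fun hn => hi ((mem_iff_of_sameCycle harc hn).mpr ⟨a, ha0, le_rfl, ha⟩)

theorem numClasses_mul_swap_of_not_sameCycle (h : ¬ σ.SameCycle i j) :
    numClasses (cycleRel (σ * Equiv.swap i j)) + 1 = numClasses (cycleRel σ) := by
  rw [← numClasses_sup_swap_of_not_rel (r := cycleRel σ) h, ← cycleRel_mul_sup_right,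
    sup_cycleRel_swap_of_rel (sameCycle_mul_swap_of_not_sameCycle h)]

theorem numClasses_mul_swap_of_sameCycle (hij : i ≠ j) (h : σ.SameCycle i j) :
    numClasses (cycleRel (σ * Equiv.swap i j)) = numClasses (cycleRel σ) + 1 := by
  have := numClasses_mul_swap_of_not_sameCycle (not_sameCycle_mul_swap hij h)
  rwa [mul_assoc, Equiv.swap_mul_self, mul_one, eq_comm] at this

variable (σ i j) in
theorem numClasses_mul_swap_le :
    numClasses (cycleRel (σ * Equiv.swap i j)) ≤ numClasses (cycleRel σ) + 1 := by
  rcases eq_or_ne i j with rfl | hij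
  · simp [← Equiv.Perm.one_def]
  by_cases h : σ.SameCycle i j
  · exact (numClasses_mul_swap_of_sameCycle hij h).le
  · have := numClasses_mul_swap_of_not_sameCycle h
    omega

end Swap

theorem numClasses_add_numClasses_mul_le (α β : Equiv.Perm X) :
    numClasses (cycleRel α) + numClasses (cycleRel β) + numClasses (cycleRel (α * β)) ≤
      Nat.card X + 2 * numClasses (cycleRel α ⊔ cycleRel β) := by
  classical
  induction hk : Nat.card X - numClasses (cycleRel β) using Nat.strong_induction_on
    generalizing β with
  | _ k ih =>
  by_cases hβ : β = 1
  · rw [hβ, cycleRel_one, mul_one, sup_bot_eq, numClasses_bot]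
    omega
  obtain ⟨i, hi⟩ : ∃ i, β i ≠ i := by
    by_contra! h
    exact hβ (Equiv.ext h)
  set j := β i
  obtain ⟨β', hβ'⟩ : ∃ β', β' = β * Equiv.swap i j := ⟨_, rfl⟩
  have hij : β.SameCycle i j := cycleRel_apply β i
  have hsplit : numClasses (cycleRel β') = numClasses (cycleRel β) + 1 :=
    hβ' ▸ numClasses_mul_swap_of_sameCycle (Ne.symm hi) hij
  have hle := numClasses_le_card (cycleRel β')
  have hind := ih _ (by omega) β' rfl
  have hsup : cycleRel α ⊔ cycleRel β =
      cycleRel α ⊔ cycleRel β' ⊔ cycleRel (Equiv.swap i j) := by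
    rw [sup_assoc, hβ', cycleRel_mul_sup_right, sup_cycleRel_swap_of_rel hij]
  have hmul : α * β = α * β' * Equiv.swap i j := by
    rw [hβ', mul_assoc, mul_assoc, Equiv.swap_mul_self, mul_one]
  by_cases hr : (cycleRel α ⊔ cycleRel β') i j
  · have := numClasses_mul_swap_le (α * β') i j
    rw [sup_cycleRel_swap_of_rel hr] at hsup
    rw [hmul, hsup]
    omega
  · have hjoin := numClasses_sup_swap_of_not_rel hr
    have hnot : ¬ (α * β').SameCycle i j := fun h =>
      hr (cycleRel_mul_le (s := cycleRel α ⊔ cycleRel β') le_sup_left le_sup_right h)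
    have := numClasses_mul_swap_of_not_sameCycle hnot
    rw [hmul, hsup]
    omega

end Cycles

theorem neg_one_pow_numClasses {X : Type*} [Fintype X] [DecidableEq X] (σ : Equiv.Perm X) :
    (-1 : ℤˣ) ^ numClasses (cycleRel σ) = (-1) ^ Fintype.card X * Equiv.Perm.sign σ := by
  induction σ using Equiv.Perm.swap_induction_on' with
  | one => rw [cycleRel_one, numClasses_bot, Nat.card_eq_fintype_card, map_one, mul_one]
  | mul_swap σ i j hij ih =>
    rw [Equiv.Perm.sign_mul, Equiv.Perm.sign_swap hij, ← mul_assoc, ← ih]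
    by_cases h : σ.SameCycle i j
    · rw [numClasses_mul_swap_of_sameCycle hij h, pow_succ]
    · rw [← numClasses_mul_swap_of_not_sameCycle h, pow_succ]
      simp only [mul_neg, mul_one, neg_neg]

/-! ### Multiplicative functions of an equivalence relation -/

section ClassProd

variable {M X Y : Type*} [CommMonoid M]

/-- `∏_V u_{|V|}` over the classes `V` of `r`, extending `u_π` from partitions to
equivalence relations on a finite type. -/
noncomputable def classProd (u : ℕ → M) (r : Setoid X) : M :=
  ∏ᶠ q : Quotient r, u (Nat.card {x // ⟦x⟧ = q})

theorem classProd_of_equiv {r : Setoid X} {s : Setoid Y} (e : X ≃ Y)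
    (h : ∀ x y, r x y ↔ s (e x) (e y)) (u : ℕ → M) : classProd u r = classProd u s := by
  refine finprod_eq_of_bijective (Quotient.congr e h) (Quotient.congr e h).bijective fun q => ?_
  refine congrArg u (Nat.card_congr (e.subtypeEquiv fun x => ?_))
  rw [← (Quotient.congr e h).injective.eq_iff]
  rfl

theorem classProd_permCongr (e : X ≃ Y) (σ : Equiv.Perm X) (u : ℕ → M) :
    classProd u (cycleRel (e.permCongr σ)) = classProd u (cycleRel σ) :=
  (classProd_of_equiv e (fun _ _ => (cycleRel_permCongr e σ).symm) u).symm

theorem numClasses_permCongr (e : X ≃ Y) (σ : Equiv.Perm X) :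
    numClasses (cycleRel (e.permCongr σ)) = numClasses (cycleRel σ) :=
  (Nat.card_congr (Quotient.congr e fun _ _ => (cycleRel_permCongr e σ).symm)).symm

theorem classProd_of_isEmpty [IsEmpty X] (u : ℕ → M) (r : Setoid X) : classProd u r = 1 :=
  finprod_of_isEmpty _

theorem classProd_top [Nonempty X] (u : ℕ → M) :
    classProd u (⊤ : Setoid X) = u (Nat.card X) := by
  have : Unique (Quotient (⊤ : Setoid X)) :=
    { default := ⟦Classical.arbitrary X⟧
      uniq := Quotient.ind fun _ => Quotient.sound trivial }
  rw [classProd, finprod_unique]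
  exact congrArg u (Nat.card_congr (Equiv.subtypeUnivEquiv fun _ => Subsingleton.elim _ _))

variable [Finite X]

theorem classProd_congr {u v : ℕ → M} (h : ∀ n, 1 ≤ n → u n = v n) (r : Setoid X) :
    classProd u r = classProd v r :=
  finprod_congr <| Quotient.ind fun x =>
    have : Nonempty {y // (⟦y⟧ : Quotient r) = ⟦x⟧} := ⟨x, rfl⟩
    h _ Nat.card_pos

theorem classProd_mul (u v : ℕ → M) (r : Setoid X) :
    classProd (fun n => u n * v n) r = classProd u r * classProd v r :=
  finprod_mul_distrib (Set.toFinite _) (Set.toFinite _)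

theorem classProd_const (c : M) (r : Setoid X) : classProd (fun _ => c) r = c ^ numClasses r := by
  cases nonempty_fintype (Quotient r)
  rw [classProd, finprod_eq_prod_of_fintype, prod_const, card_univ, numClasses,
    Nat.card_eq_fintype_card]

theorem sum_card_fibers [Fintype X] (r : Setoid X) [Fintype (Quotient r)] :
    ∑ q : Quotient r, Nat.card {x // ⟦x⟧ = q} = Fintype.card X := by
  rw [← Nat.card_sigma, Nat.card_congr (Equiv.sigmaFiberEquiv (Quotient.mk r)),
    Nat.card_eq_fintype_card]

theorem classProd_pow [Fintype X] (c : M) (r : Setoid X) :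
    classProd (fun n => c ^ n) r = c ^ Fintype.card X := by
  cases nonempty_fintype (Quotient r)
  rw [classProd, finprod_eq_prod_of_fintype, prod_pow_eq_pow_sum, sum_card_fibers]

theorem classProd_pow_pred_mul [Fintype X] (c : M) (u : ℕ → M) (r : Setoid X) :
    classProd (fun n => c ^ (n - 1) * u n) r =
      c ^ (Fintype.card X - numClasses r) * classProd u r := by
  cases nonempty_fintype (Quotient r)
  have hpos : ∀ q ∈ univ, 1 ≤ Nat.card {x // (⟦x⟧ : Quotient r) = q} := fun q _ =>
    q.inductionOn fun x =>
      have : Nonempty {y // (⟦y⟧ : Quotient r) = ⟦x⟧} := ⟨x, rfl⟩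
      Nat.card_pos
  rw [classProd_mul, classProd, finprod_eq_prod_of_fintype, prod_pow_eq_pow_sum,
    sum_tsub_distrib _ hpos, sum_card_fibers, sum_const, smul_eq_mul, mul_one, card_univ,
    numClasses, Nat.card_eq_fintype_card]

theorem classProd_eq_mul_of_le_ker {r : Setoid X} {p : X → Prop} (hr : r ≤ Setoid.ker p)
    (u : ℕ → M) :
    classProd u r = classProd u (r.comap (Subtype.val : {x // p x} → X)) *
      classProd u (r.comap (Subtype.val : {x // ¬ p x} → X)) := by
  classical
  have restrict {p : X → Prop} (P : Quotient r → Prop) (hP : ∀ x, p x ↔ P ⟦x⟧) :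
      ∏ᶠ q : {q // P q}, u (Nat.card {x // ⟦x⟧ = q.1}) =
        classProd u (r.comap (Subtype.val : {x // p x} → X)) := by
    let e : {q // P q} ≃ Quotient (r.comap (Subtype.val : {x // p x} → X)) :=
      Equiv.subtypeQuotientEquivQuotientSubtype p P hP fun _ _ => Iff.rfl
    refine finprod_eq_of_bijective e e.bijective ?_
    rintro ⟨q, hq⟩
    refine congrArg u (Nat.card_congr ?_)
    have hp : ∀ {x}, ⟦x⟧ = q → p x := fun hx => (hP _).mpr (hx ▸ hq)
    refine (Equiv.subtypeSubtypeEquivSubtype hp).symm.trans (Equiv.subtypeEquivRight fun x => ?_)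
    rw [← e.symm_apply_eq, Subtype.ext_iff]
    rfl
  let P : Quotient r → Prop := Quotient.lift p fun _ _ h => hr h
  cases nonempty_fintype (Quotient r)
  rw [← restrict (p := p) P fun _ => Iff.rfl, ← restrict (p := (¬ p ·)) (¬ P ·) fun _ => Iff.rfl,
    finprod_eq_prod_of_fintype, finprod_eq_prod_of_fintype, classProd, finprod_eq_prod_of_fintype]
  exact (Fintype.prod_subtype_mul_prod_subtype P _).symm

end ClassProd

section SubtypeCongr

variable {M X : Type*} [CommMonoid M] {p : X → Prop} [DecidablePred p]

theorem cycleRel_subtypeCongr_le_ker (a : Equiv.Perm {x // p x}) (b : Equiv.Perm {x // ¬ p x}) :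
    cycleRel (a.subtypeCongr b) ≤ Setoid.ker p := by
  refine cycleRel_le_iff.mpr fun x => propext ?_
  by_cases hx : p x
  · simpa only [Equiv.Perm.subtypeCongr.left_apply _ _ hx, hx, true_iff] using (a ⟨x, hx⟩).2
  · simpa only [Equiv.Perm.subtypeCongr.right_apply _ _ hx, hx, false_iff] using (b ⟨x, hx⟩).2

theorem subtypeCongr_zpow (a : Equiv.Perm {x // p x}) (b : Equiv.Perm {x // ¬ p x}) (k : ℤ) :
    a.subtypeCongr b ^ k = (a ^ k).subtypeCongr (b ^ k) :=
  (map_zpow (Equiv.Perm.subtypeCongrHom p) (a, b) k).symm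

theorem comap_cycleRel_subtypeCongr_left (a : Equiv.Perm {x // p x})
    (b : Equiv.Perm {x // ¬ p x}) :
    (cycleRel (a.subtypeCongr b)).comap Subtype.val = cycleRel a := by
  ext x y
  refine exists_congr fun k => ?_
  rw [subtypeCongr_zpow, Equiv.Perm.subtypeCongr.left_apply_subtype, Subtype.coe_inj]

theorem comap_cycleRel_subtypeCongr_right (a : Equiv.Perm {x // p x})
    (b : Equiv.Perm {x // ¬ p x}) :
    (cycleRel (a.subtypeCongr b)).comap Subtype.val = cycleRel b := by
  ext x y
  refine exists_congr fun k => ?_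
  rw [subtypeCongr_zpow, Equiv.Perm.subtypeCongr.right_apply_subtype, Subtype.coe_inj]

theorem classProd_subtypeCongr [Finite X] (a : Equiv.Perm {x // p x})
    (b : Equiv.Perm {x // ¬ p x}) (u : ℕ → M) :
    classProd u (cycleRel (a.subtypeCongr b)) =
      classProd u (cycleRel a) * classProd u (cycleRel b) := by
  rw [classProd_eq_mul_of_le_ker (cycleRel_subtypeCongr_le_ker a b),
    comap_cycleRel_subtypeCongr_left, comap_cycleRel_subtypeCongr_right]

theorem numClasses_subtypeCongr [Finite X] (a : Equiv.Perm {x // p x})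
    (b : Equiv.Perm {x // ¬ p x}) :
    numClasses (cycleRel (a.subtypeCongr b)) =
      numClasses (cycleRel a) + numClasses (cycleRel b) := by
  have h := classProd_subtypeCongr a b fun _ => 2
  simp only [classProd_const, ← pow_add] at h
  exact Nat.pow_right_injective le_rfl h

theorem exists_subtypeCongr {α : Equiv.Perm X}
    (h : cycleRel α ≤ Setoid.ker p) :
    ∃ (a : Equiv.Perm {x // p x}) (b : Equiv.Perm {x // ¬ p x}), a.subtypeCongr b = α := by
  have hp : ∀ x, p (α x) ↔ p x := fun x => (h (cycleRel_apply α x)).symm.to_iff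
  refine ⟨α.subtypePerm hp, α.subtypePerm fun x => not_congr (hp x), ?_⟩
  ext x
  by_cases hx : p x
  · rw [Equiv.Perm.subtypeCongr.left_apply _ _ hx]; rfl
  · rw [Equiv.Perm.subtypeCongr.right_apply _ _ hx]; rfl

theorem comap_sup_cycleRel_subtypeCongr (a₁ a₂ : Equiv.Perm {x // p x})
    (b₁ b₂ : Equiv.Perm {x // ¬ p x}) :
    (cycleRel (a₁.subtypeCongr b₁) ⊔ cycleRel (a₂.subtypeCongr b₂)).comap Subtype.val =
      cycleRel a₁ ⊔ cycleRel a₂ := by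
  apply le_antisymm
  · let collapse : X → Option (Quotient (cycleRel a₁ ⊔ cycleRel a₂)) := fun x =>
      if hx : p x then some ⟦⟨x, hx⟩⟧ else none
    have le_ker : ∀ (a : Equiv.Perm {x // p x}) (b : Equiv.Perm {x // ¬ p x}),
        cycleRel a ≤ cycleRel a₁ ⊔ cycleRel a₂ →
        cycleRel (a.subtypeCongr b) ≤ Setoid.ker collapse := by
      refine fun a b ha => cycleRel_le_iff.mpr fun x => Setoid.ker_def.mpr ?_
      by_cases hx : p x
      · simp only [Equiv.Perm.subtypeCongr.left_apply _ _ hx, collapse, dif_pos hx,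
          dif_pos (a ⟨x, hx⟩).2]
        exact congrArg some (Quotient.sound (ha (cycleRel_apply a ⟨x, hx⟩)))
      · simp only [Equiv.Perm.subtypeCongr.right_apply _ _ hx, collapse, dif_neg hx,
          dif_neg (b ⟨x, hx⟩).2]
    intro x y hxy
    have h := sup_le (le_ker a₁ b₁ le_sup_left) (le_ker a₂ b₂ le_sup_right) hxy
    simp only [Setoid.ker_def, collapse, dif_pos x.2, dif_pos y.2] at h
    exact Quotient.exact (Option.some_injective _ h)
  · refine sup_le ?_ ?_
    · rw [← comap_cycleRel_subtypeCongr_left a₁ b₁]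
      exact fun _ _ h => le_sup_left (b := cycleRel (a₂.subtypeCongr b₂)) h
    · rw [← comap_cycleRel_subtypeCongr_left a₂ b₂]
      exact fun _ _ h => le_sup_right (a := cycleRel (a₁.subtypeCongr b₁)) h

theorem forall_sup_cycleRel_subtypeCongr_iff {x₀ : X} (hx₀ : p x₀) (a₁ a₂ : Equiv.Perm {x // p x})
    (b₁ b₂ : Equiv.Perm {x // ¬ p x}) :
    (∀ x, (cycleRel (a₁.subtypeCongr b₁) ⊔ cycleRel (a₂.subtypeCongr b₂)) x₀ x ↔ p x) ↔
      cycleRel a₁ ⊔ cycleRel a₂ = ⊤ := by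
  have hcomap := comap_sup_cycleRel_subtypeCongr a₁ a₂ b₁ b₂
  have hker := sup_le (cycleRel_subtypeCongr_le_ker a₁ b₁) (cycleRel_subtypeCongr_le_ker a₂ b₂)
  set r := cycleRel (a₁.subtypeCongr b₁) ⊔ cycleRel (a₂.subtypeCongr b₂)
  rw [← hcomap]
  refine ⟨fun h => top_le_iff.mp fun x y _ => ?_, fun h x => ⟨fun hx => ?_, fun hx => ?_⟩⟩
  · exact r.trans (r.symm ((h x).mpr x.2)) ((h y).mpr y.2)
  · exact (hker hx).mp hx₀
  · exact (h ▸ trivial : r.comap Subtype.val ⟨x₀, hx₀⟩ ⟨x, hx⟩)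

end SubtypeCongr

section TransitivePairs

variable {R X : Type*} [AddCommMonoid R] [Fintype X] [DecidableEq X]

open Classical in
/-- The pairs of permutations of `X` that generate a transitive group. -/
noncomputable def transitivePairs (X : Type*) [Fintype X] [DecidableEq X] :
    Finset (Equiv.Perm X × Equiv.Perm X) :=
  univ.filter fun a => cycleRel a.1 ⊔ cycleRel a.2 = ⊤

theorem mem_transitivePairs {a : Equiv.Perm X × Equiv.Perm X} :
    a ∈ transitivePairs X ↔ cycleRel a.1 ⊔ cycleRel a.2 = ⊤ := by
  simp only [transitivePairs, mem_filter, mem_univ, true_and]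

theorem sum_perm_prod_perm_eq_sum_orbit (x₀ : X) (f : Equiv.Perm X × Equiv.Perm X → R) :
    ∑ a, f a = ∑ S : Finset X with x₀ ∈ S,
      ∑ a ∈ transitivePairs {x // x ∈ S},
        ∑ b : Equiv.Perm {x // x ∉ S} × Equiv.Perm {x // x ∉ S},
          f (a.1.subtypeCongr b.1, a.2.subtypeCongr b.2) := by
  classical
  let orbit : Equiv.Perm X × Equiv.Perm X → Finset X := fun a =>
    univ.filter ((cycleRel a.1 ⊔ cycleRel a.2) x₀ ·)
  have orbit_eq_iff {a S} : orbit a = S ↔ ∀ x, (cycleRel a.1 ⊔ cycleRel a.2) x₀ x ↔ x ∈ S := by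
    simp only [Finset.ext_iff, orbit, mem_filter, mem_univ, true_and]
  rw [← sum_fiberwise_of_maps_to (t := univ.filter (x₀ ∈ ·)) (g := orbit) fun a _ =>
    mem_filter.mpr ⟨mem_univ _, ((orbit_eq_iff (a := a)).mp rfl x₀).mp (Setoid.refl' _ x₀)⟩]
  refine sum_congr rfl fun S hS => ?_
  have hx₀ : x₀ ∈ S := (mem_filter.mp hS).2
  rw [← sum_product', eq_comm]
  refine sum_bij (fun c _ => (c.1.1.subtypeCongr c.2.1, c.1.2.subtypeCongr c.2.2)) ?_ ?_ ?_
    fun _ _ => rfl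
  · rintro ⟨a, b⟩ hab
    rw [mem_filter, orbit_eq_iff]
    exact ⟨mem_univ _, (forall_sup_cycleRel_subtypeCongr_iff hx₀ _ _ _ _).mpr
      (mem_transitivePairs.mp (mem_product.mp hab).1)⟩
  · rintro ⟨⟨a₁, a₂⟩, b₁, b₂⟩ - ⟨⟨a₁', a₂'⟩, b₁', b₂'⟩ - h
    have h₁ := Equiv.Perm.subtypeCongrHom_injective (· ∈ S)
      (a₁ := (a₁, b₁)) (a₂ := (a₁', b₁')) (congrArg Prod.fst h)
    have h₂ := Equiv.Perm.subtypeCongrHom_injective (· ∈ S)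
      (a₁ := (a₂, b₂)) (a₂ := (a₂', b₂')) (congrArg Prod.snd h)
    grind
  · rintro ⟨α, β⟩ hab
    have horbit := orbit_eq_iff.mp (mem_filter.mp hab).2
    have hker : cycleRel α ⊔ cycleRel β ≤ Setoid.ker (· ∈ S) := fun x y hxy => by
      rw [Setoid.ker_def, ← horbit, ← horbit]
      exact propext ⟨(Setoid.trans' _ · hxy), (Setoid.trans' _ · (Setoid.symm' _ hxy))⟩
    obtain ⟨a₁, b₁, rfl⟩ := exists_subtypeCongr (le_sup_left.trans hker)
    obtain ⟨a₂, b₂, rfl⟩ := exists_subtypeCongr (le_sup_right.trans hker)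
    refine ⟨((a₁, a₂), b₁, b₂), mem_product.mpr ⟨mem_transitivePairs.mpr ?_, mem_univ _⟩, rfl⟩
    exact (forall_sup_cycleRel_subtypeCongr_iff hx₀ a₁ a₂ b₁ b₂).mp horbit

end TransitivePairs

/-! ### Cumulants of a sequence and connected pairs of permutations -/

section HasCumulants

variable {R X : Type*} [CommRing R] {e e' c c' : ℕ → R}

/-- `c 1, c 2, …` are the classical cumulants of the sequence `e`: the exponential generating
function of `e` is the exponential of that of `c`. The value `c 0` is irrelevant. -/
def HasCumulants (e c : ℕ → R) : Prop :=
  ∀ n, e (n + 1) = ∑ k ∈ range (n + 1), (n.choose k : R) * c (k + 1) * e (n - k)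

theorem HasCumulants.cumulant_unique (h0 : e 0 = 1) (h : HasCumulants e c)
    (h' : HasCumulants e c') (n : ℕ) : c (n + 1) = c' (n + 1) := by
  induction n using Nat.strong_induction_on with | _ n ih
  have hlower : ∑ k ∈ range n, (n.choose k : R) * c (k + 1) * e (n - k) =
      ∑ k ∈ range n, (n.choose k : R) * c' (k + 1) * e (n - k) :=
    sum_congr rfl fun k hk => by rw [ih k (mem_range.mp hk)]
  have hn := (h n).symm.trans (h' n)
  rw [sum_range_succ, sum_range_succ, hlower] at hn
  simpa [h0] using hn

theorem HasCumulants.moment_unique (h0 : e 0 = e' 0) (h : HasCumulants e c)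
    (h' : HasCumulants e' c) (n : ℕ) : e n = e' n := by
  induction n using Nat.strong_induction_on with | _ n ih
  cases n with
  | zero => exact h0
  | succ n =>
    rw [h n, h' n]
    exact sum_congr rfl fun k _ => by rw [ih (n - k) (by omega)]

theorem HasCumulants.congr (h : HasCumulants e c) (hc : ∀ n, c (n + 1) = c' (n + 1)) :
    HasCumulants e c' := fun n => by
  rw [h n]
  exact sum_congr rfl fun k _ => by rw [hc]

theorem sum_powerset_mem_mul [DecidableEq X] {s : Finset X} {x₀ : X} (hx₀ : x₀ ∈ s)
    (e c : ℕ → R) :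
    ∑ S ∈ s.powerset with x₀ ∈ S, c #S * e (#s - #S) =
      ∑ k ∈ range #s, ((#s - 1).choose k : R) * c (k + 1) * e (#s - 1 - k) := by
  obtain ⟨t, hx, rfl⟩ : ∃ t, x₀ ∉ t ∧ insert x₀ t = s :=
    ⟨s.erase x₀, notMem_erase _ _, insert_erase hx₀⟩
  have hnotMem : ∀ S ∈ t.powerset, x₀ ∉ S := fun S hS h => hx (mem_powerset.mp hS h)
  have hinsert : ∀ S ∈ t.powerset, (if x₀ ∈ insert x₀ S then
      c #(insert x₀ S) * e (#(insert x₀ t) - #(insert x₀ S)) else 0) =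
      c (#S + 1) * e (#t - #S) := fun S hS => by
    rw [if_pos (mem_insert_self _ _), card_insert_of_notMem (hnotMem S hS),
      card_insert_of_notMem hx, Nat.add_sub_add_right]
  rw [sum_filter, sum_powerset_insert hx, sum_eq_zero fun S hS => if_neg (hnotMem S hS), zero_add,
    sum_congr rfl hinsert, sum_powerset_apply_card fun k => c (k + 1) * e (#t - k),
    card_insert_of_notMem hx, Nat.add_sub_cancel]
  simp only [nsmul_eq_mul, mul_assoc]

theorem HasCumulants.apply_card [DecidableEq X] (h : HasCumulants e c) {s : Finset X} {x₀ : X}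
    (hx₀ : x₀ ∈ s) : e #s = ∑ S ∈ s.powerset with x₀ ∈ S, c #S * e (#s - #S) := by
  obtain ⟨n, hn⟩ : ∃ n, #s = n + 1 := ⟨_, (Nat.sub_add_cancel (card_pos.mpr ⟨x₀, hx₀⟩)).symm⟩
  rw [sum_powerset_mem_mul hx₀, hn, h, Nat.add_sub_cancel]

theorem hasCumulants_of_forall_eq_sum (h : ∀ n, e (n + 1) =
    ∑ S : Finset (Fin (n + 1)) with 0 ∈ S, c #S * e (n + 1 - #S)) : HasCumulants e c := fun n => by
  have hsum := sum_powerset_mem_mul (mem_univ (0 : Fin (n + 1))) e c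
  rwa [powerset_univ, card_univ, Fintype.card_fin, ← h, Nat.add_sub_cancel] at hsum

end HasCumulants

section PermSum

variable {R : Type*} [CommRing R]

/-- `∑_σ u_σ` over all permutations of `X`. -/
noncomputable def permSum (X : Type*) [Fintype X] [DecidableEq X] (u : ℕ → R) : R :=
  ∑ σ : Equiv.Perm X, classProd u (cycleRel σ)

/-- `∑ u_α v_β` over all pairs `(α, β)` that generate a transitive group on `X`. -/
noncomputable def transitiveSum (X : Type*) [Fintype X] [DecidableEq X] (u v : ℕ → R) : R :=
  ∑ a ∈ transitivePairs X, classProd u (cycleRel a.1) * classProd v (cycleRel a.2)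

theorem cycleRel_sup_permCongr_eq_top {X Y : Type*} (e : X ≃ Y) {α β : Equiv.Perm X}
    (h : cycleRel α ⊔ cycleRel β = ⊤) :
    cycleRel (e.permCongr α) ⊔ cycleRel (e.permCongr β) = ⊤ := by
  have hle : ⊤ ≤ (cycleRel (e.permCongr α) ⊔ cycleRel (e.permCongr β)).comap e := by
    rw [← h]
    refine sup_le (fun x y hxy => ?_) (fun x y hxy => ?_)
    · exact (le_sup_left : cycleRel (e.permCongr α) ≤ _) ((cycleRel_permCongr e α).mpr hxy)
    · exact (le_sup_right : cycleRel (e.permCongr β) ≤ _) ((cycleRel_permCongr e β).mpr hxy)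
  refine top_le_iff.mp fun x y _ => ?_
  simpa [Setoid.comap_rel] using hle (x := e.symm x) (y := e.symm y) trivial

theorem cycleRel_sup_permCongr_eq_top_iff {X Y : Type*} (e : X ≃ Y) {α β : Equiv.Perm X} :
    cycleRel (e.permCongr α) ⊔ cycleRel (e.permCongr β) = ⊤ ↔ cycleRel α ⊔ cycleRel β = ⊤ := by
  refine ⟨fun h => ?_, cycleRel_sup_permCongr_eq_top e⟩
  simpa only [← Equiv.permCongr_symm, Equiv.symm_apply_apply] using
    cycleRel_sup_permCongr_eq_top e.symm h

section

variable {X : Type*} [Fintype X] [DecidableEq X]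

theorem permSum_eq_fin {n : ℕ} (hn : Fintype.card X = n) (u : ℕ → R) :
    permSum X u = permSum (Fin n) u :=
  Fintype.sum_equiv (Fintype.equivFinOfCardEq hn).permCongr _ _ fun σ =>
    (classProd_permCongr _ σ u).symm

theorem transitiveSum_eq_fin {n : ℕ} (hn : Fintype.card X = n) (u v : ℕ → R) :
    transitiveSum X u v = transitiveSum (Fin n) u v := by
  let e := (Fintype.equivFinOfCardEq hn).permCongr
  refine sum_equiv (e.prodCongr e) (fun a => ?_) fun a _ => ?_
  · rw [mem_transitivePairs, mem_transitivePairs]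
    exact (cycleRel_sup_permCongr_eq_top_iff _).symm
  · exact (congrArg₂ (· * ·) (classProd_permCongr _ _ u) (classProd_permCongr _ _ v)).symm

theorem sum_classProd_mul_eq_sum_orbit (x₀ : X) (u v : ℕ → R) :
    permSum X u * permSum X v = ∑ S : Finset X with x₀ ∈ S,
      transitiveSum {x // x ∈ S} u v *
        (permSum {x // x ∉ S} u * permSum {x // x ∉ S} v) := by
  rw [permSum, permSum, Fintype.sum_mul_sum, ← Fintype.sum_prod_type',
    sum_perm_prod_perm_eq_sum_orbit x₀]
  refine sum_congr rfl fun S _ => ?_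
  rw [transitiveSum, permSum, permSum, Fintype.sum_mul_sum, ← Fintype.sum_prod_type', sum_mul_sum]
  refine sum_congr rfl fun a _ => sum_congr rfl fun b _ => ?_
  rw [classProd_subtypeCongr, classProd_subtypeCongr, mul_mul_mul_comm]

end

theorem permSum_fin_zero (u : ℕ → R) : permSum (Fin 0) u = 1 := by
  simp [permSum, classProd_of_isEmpty]

theorem hasCumulants_transitiveSum (u v : ℕ → R) :
    HasCumulants (fun n => permSum (Fin n) u * permSum (Fin n) v)
      (fun n => transitiveSum (Fin n) u v) := by
  refine hasCumulants_of_forall_eq_sum fun n => ?_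
  rw [sum_classProd_mul_eq_sum_orbit 0]
  refine sum_congr rfl fun S _ => ?_
  have hS : Fintype.card {x // x ∉ S} = n + 1 - #S := by
    rw [Fintype.card_subtype_compl, Fintype.card_fin, Fintype.card_coe]
  rw [transitiveSum_eq_fin (Fintype.card_coe S), permSum_eq_fin hS, permSum_eq_fin hS]

open Classical in
/-- The permutations of `X` with exactly one cycle (the empty permutation is included when `X` is
empty). -/
noncomputable def longCycles (X : Type*) [Fintype X] [DecidableEq X] : Finset (Equiv.Perm X) :=
  univ.filter fun σ => cycleRel σ = ⊤

theorem mem_longCycles {X : Type*} [Fintype X] [DecidableEq X] {σ : Equiv.Perm X} :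
    σ ∈ longCycles X ↔ cycleRel σ = ⊤ := by
  simp only [longCycles, mem_filter, mem_univ, true_and]

theorem classProd_single_one {X : Type*} [Fintype X] [DecidableEq X] (σ : Equiv.Perm X) :
    classProd (Pi.single 1 1 : ℕ → R) (cycleRel σ) = if σ = 1 then 1 else 0 := by
  split_ifs with h
  · rw [h, cycleRel_one]
    refine finprod_eq_one_of_forall_eq_one <| Quotient.ind fun x => ?_
    have hcard : Nat.card {y // (Quotient.mk (⊥ : Setoid X) y) = ⟦x⟧} = 1 :=
      (Nat.card_congr (Equiv.subtypeEquivRight fun y => Quotient.eq)).trans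
        (Nat.card_unique (α := {y // y = x}))
    rw [hcard, Pi.single_eq_same]
  · obtain ⟨x, hx⟩ : ∃ x, σ x ≠ x := by
      contrapose! h
      exact Equiv.ext h
    cases nonempty_fintype (Quotient (cycleRel σ))
    rw [classProd, finprod_eq_prod_of_fintype]
    refine prod_eq_zero (mem_univ ⟦x⟧) (Pi.single_eq_of_ne (fun hcard => hx ?_) 1)
    have := (Nat.card_eq_one_iff_unique.mp hcard).1
    exact congrArg Subtype.val (Subsingleton.elim
      (⟨σ x, Quotient.sound (Setoid.symm' _ (cycleRel_apply σ x))⟩ :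
        {y // (Quotient.mk (cycleRel σ) y) = ⟦x⟧}) ⟨x, rfl⟩)

theorem transitiveSum_single_one {X : Type*} [Fintype X] [DecidableEq X] [Nonempty X]
    (u : ℕ → R) :
    transitiveSum X u (Pi.single 1 1) = #(longCycles X) * u (Fintype.card X) := by
  simp only [transitiveSum, transitivePairs, sum_filter, Fintype.sum_prod_type,
    classProd_single_one, mul_ite, mul_one, mul_zero, longCycles, card_eq_sum_ones, Nat.cast_sum,
    sum_mul]
  refine sum_congr rfl fun σ _ => ?_
  rw [sum_eq_single 1 (fun τ _ hτ => by rw [if_neg hτ, ite_self])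
    (fun h => absurd (mem_univ _) h), if_pos rfl, cycleRel_one, sup_bot_eq]
  split_ifs with h
  · rw [h, classProd_top, Nat.card_eq_fintype_card, Nat.cast_one, one_mul]
  · rw [Nat.cast_zero, zero_mul]

theorem hasCumulants_permSum_card_longCycles (u : ℕ → R) :
    HasCumulants (fun n => permSum (Fin n) u) (fun n => #(longCycles (Fin n)) * u n) := by
  -- Restrict the second permutation of a pair to be the identity.
  have h := hasCumulants_transitiveSum u (Pi.single 1 1)
  have hone : ∀ n, permSum (Fin n) (Pi.single 1 1 : ℕ → R) = 1 := fun n => by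
    simp only [permSum, classProd_single_one, sum_ite_eq', mem_univ, if_true]
  simp only [hone, mul_one] at h
  exact h.congr fun n => by rw [transitiveSum_single_one, Fintype.card_fin]

theorem card_longCycles (n : ℕ) : #(longCycles (Fin (n + 1))) = n.factorial := by
  have hperm : ∀ n, permSum (Fin n) (fun _ => (1 : ℤ)) = n.factorial := fun n => by
    simp [permSum, classProd_const, Fintype.card_perm]
  have h := hasCumulants_permSum_card_longCycles fun _ => (1 : ℤ)
  simp only [hperm, mul_one] at h
  have hfac : HasCumulants (fun n => (n.factorial : ℤ)) (fun n => ((n - 1).factorial : ℤ)) := by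
    intro n
    have hterm : ∀ k ∈ range (n + 1), (n.choose k : ℤ) * ((k + 1 - 1).factorial : ℤ) *
        ((n - k).factorial : ℤ) = n.factorial := fun k hk => by
      rw [Nat.add_sub_cancel]
      exact_mod_cast Nat.choose_mul_factorial_mul_factorial (Nat.lt_succ_iff.mp (mem_range.mp hk))
    rw [sum_congr rfl hterm, sum_const, card_range, nsmul_eq_mul]
    simp [Nat.factorial_succ]
  exact_mod_cast h.cumulant_unique (by simp) hfac n

theorem hasCumulants_permSum (u : ℕ → R) :
    HasCumulants (fun n => permSum (Fin n) u) (fun n => ((n - 1).factorial : R) * u n) :=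
  (hasCumulants_permSum_card_longCycles u).congr fun n => by
    rw [card_longCycles, Nat.add_sub_cancel]

end PermSum

/-! ### Cumulants as sums over set partitions -/

section SetPartitionSum

variable {M R X : Type*} [DecidableEq X]

theorem sup_erase_parts {s B : Finset X} (π : Finpartition s) (hB : B ∈ π.parts) :
    (π.parts.erase B).sup id = s \ B := by
  have hdisj : Disjoint B ((π.parts.erase B).sup id) :=
    π.supIndep (erase_subset _ _) hB (notMem_erase _ _)
  conv_rhs => rw [← π.sup_parts, ← insert_erase hB, sup_insert]
  exact hdisj.sup_sdiff_cancel_left.symm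

theorem sum_erase_block [AddCommMonoid M] (s : Finset X)
    (f : Finset X → Finset (Finset X) → M) :
    ∑ B ∈ s.powerset.erase ∅, ∑ π : Finpartition (s \ B), f B (insert B π.parts) =
      ∑ π : Finpartition s, ∑ B ∈ π.parts, f B π.parts := by
  have hblock {B : Finset X} (hB : B ∈ s.powerset.erase ∅) : B ≠ ⊥ ∧ B ⊆ s :=
    (mem_erase.mp hB).imp_right mem_powerset.mp
  rw [sum_sigma', sum_sigma']
  refine sum_bij (fun c hc => ⟨c.2.extend (hblock (mem_sigma.mp hc).1).1 sdiff_disjoint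
    (sdiff_sup_cancel (hblock (mem_sigma.mp hc).1).2), c.1⟩) ?mem ?inj ?surj fun _ _ => rfl
  case mem => exact fun c _ => mem_sigma.mpr ⟨mem_univ _, mem_insert_self _ _⟩
  case inj =>
    rintro ⟨B, π⟩ hc ⟨B', π'⟩ hc' heq
    obtain rfl : B = B' := congrArg Sigma.snd heq
    have hne := (hblock (mem_sigma.mp hc).1).1
    have hnotMem (ρ : Finpartition (s \ B)) : B ∉ ρ.parts := fun h =>
      hne (sdiff_disjoint.symm.eq_bot_of_le (ρ.le h))
    have hparts : insert B π.parts = insert B π'.parts :=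
      congrArg (fun c : Σ _ : Finpartition s, Finset X => c.1.parts) heq
    obtain rfl : π = π' := Finpartition.ext <| by
      rw [← erase_insert (hnotMem π), hparts, erase_insert (hnotMem π')]
    rfl
  case surj =>
    rintro ⟨π, B⟩ hc
    have hB : B ∈ π.parts := (mem_sigma.mp hc).2
    refine ⟨⟨B, π.ofSubset (erase_subset B _) (sup_erase_parts π hB)⟩, mem_sigma.mpr
      ⟨mem_erase.mpr ⟨π.ne_bot hB, mem_powerset.mpr (π.le hB)⟩, mem_univ _⟩, ?_⟩
    exact Sigma.ext (Finpartition.ext (insert_erase hB)) HEq.rfl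

variable [CommRing R]

/-- The Möbius function `(-1)^{k-1} (k-1)!` of the lattice of set partitions, between a partition
with `k ≥ 1` blocks and the partition with one block. -/
def partitionMoebius (R : Type*) [CommRing R] (k : ℕ) : R := (-1) ^ (k - 1) * (k - 1).factorial

theorem partitionMoebius_succ (k : ℕ) :
    partitionMoebius R (k + 1) + k * partitionMoebius R k = if k = 0 then 1 else 0 := by
  cases k with
  | zero => simp [partitionMoebius]
  | succ k =>
    simp only [partitionMoebius, Nat.factorial_succ, pow_succ, Nat.add_sub_cancel,
      Nat.succ_ne_zero, if_false]
    push_cast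
    ring

/-- The `#s`-th cumulant of `e`, as a sum over the partitions of `s`. -/
def partitionCumulant (e : ℕ → R) (s : Finset X) : R :=
  ∑ π : Finpartition s, partitionMoebius R #π.parts * ∏ V ∈ π.parts, e #V

theorem card_filter_notMem_parts {s : Finset X} {x₀ : X} (hx₀ : x₀ ∈ s) (π : Finpartition s) :
    #{B ∈ π.parts | x₀ ∉ B} = #π.parts - 1 := by
  rw [← card_erase_of_mem (π.part_mem.mpr hx₀)]
  congr 1
  ext B
  rw [mem_filter, mem_erase, and_comm]
  refine and_congr_left fun hB => not_congr ?_
  rw [eq_comm, π.part_eq_iff_mem hB]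

theorem sum_card_parts_eq_one {s : Finset X} (hs : s.Nonempty) (e : ℕ → R) :
    ∑ π : Finpartition s, (if #π.parts = 1 then ∏ V ∈ π.parts, e #V else 0) = e #s := by
  rw [sum_eq_single (Finpartition.indiscrete hs.ne_empty)]
  · simp
  · intro π _ hπ
    refine if_neg fun hcard => hπ ?_
    obtain ⟨V, hV⟩ := card_eq_one.mp hcard
    have : V = s := by simpa [hV] using π.sup_parts
    exact Finpartition.ext (by rw [hV, this]; rfl)
  · exact fun h => absurd (mem_univ _) h

theorem sum_filter_notMem_partitionMoebius {s : Finset X} {x₀ : X} (hx₀ : x₀ ∈ s) (e : ℕ → R)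
    (π : Finpartition s) :
    partitionMoebius R #π.parts * ∏ V ∈ π.parts, e #V +
        ∑ B ∈ π.parts with x₀ ∉ B, partitionMoebius R (#π.parts - 1) * ∏ V ∈ π.parts, e #V =
      if #π.parts = 1 then ∏ V ∈ π.parts, e #V else 0 := by
  obtain ⟨k, hk⟩ : ∃ k, #π.parts = k + 1 :=
    ⟨_, (Nat.sub_add_cancel (card_pos.mpr ⟨_, π.part_mem.mpr hx₀⟩)).symm⟩
  rw [sum_const, card_filter_notMem_parts hx₀, hk, Nat.add_sub_cancel, nsmul_eq_mul, ← mul_assoc,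
    ← add_mul, partitionMoebius_succ]
  simp

theorem sum_partitionCumulant_sdiff_mul {s : Finset X} {x₀ : X} (e : ℕ → R) :
    ∑ B ∈ (s.powerset.filter (x₀ ∉ ·)).erase ∅, partitionCumulant e (s \ B) * e #B =
      ∑ π : Finpartition s, ∑ B ∈ π.parts with x₀ ∉ B,
        partitionMoebius R (#π.parts - 1) * ∏ V ∈ π.parts, e #V := by
  simp only [sum_filter]
  rw [← sum_erase_block s fun B P =>
    if x₀ ∉ B then partitionMoebius R (#P - 1) * ∏ V ∈ P, e #V else 0, ← filter_erase, sum_filter]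
  refine sum_congr rfl fun B hB => ?_
  by_cases hx : x₀ ∈ B
  · simp [hx]
  simp only [hx, not_false_eq_true, if_true, partitionCumulant, sum_mul]
  refine sum_congr rfl fun π _ => ?_
  have hnotMem : B ∉ π.parts := fun h =>
    ne_of_mem_erase hB (sdiff_disjoint.symm.eq_bot_of_le (π.le h))
  rw [card_insert_of_notMem hnotMem, prod_insert hnotMem, Nat.add_sub_cancel, mul_assoc,
    mul_comm (e #B)]

theorem sum_partitionCumulant_mul {s : Finset X} {x₀ : X} (hx₀ : x₀ ∈ s) {e : ℕ → R}
    (h0 : e 0 = 1) :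
    ∑ S ∈ s.powerset with x₀ ∈ S, partitionCumulant e S * e (#s - #S) = e #s := by
  have hcompl : ∑ S ∈ s.powerset with x₀ ∈ S, partitionCumulant e S * e (#s - #S) =
      ∑ B ∈ s.powerset with x₀ ∉ B, partitionCumulant e (s \ B) * e #B := by
    refine sum_nbij' (s \ ·) (s \ ·) ?_ ?_ ?_ ?_ ?_ <;> intro S hS <;>
      simp only [mem_filter, mem_powerset] at hS ⊢
    · simp [hS.2]
    · simp [hS.2, hx₀]
    · exact Finset.sdiff_sdiff_eq_self hS.1
    · exact Finset.sdiff_sdiff_eq_self hS.1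
    · rw [Finset.sdiff_sdiff_eq_self hS.1, card_sdiff_of_subset hS.1]
  have hempty : ∅ ∈ s.powerset.filter (x₀ ∉ ·) := by simp
  rw [hcompl, ← add_sum_erase _ _ hempty, sum_partitionCumulant_sdiff_mul, sdiff_empty, card_empty,
    h0, mul_one, partitionCumulant, ← sum_add_distrib,
    sum_congr rfl fun π _ => sum_filter_notMem_partitionMoebius hx₀ e π,
    sum_card_parts_eq_one ⟨x₀, hx₀⟩]

theorem HasCumulants.partitionCumulant_eq {e c : ℕ → R} (h0 : e 0 = 1) (h : HasCumulants e c)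
    {s : Finset X} (hs : s.Nonempty) : partitionCumulant e s = c #s := by
  induction s using Finset.strongInduction with | _ s ih
  obtain ⟨x₀, hx₀⟩ := hs
  have hmem : s ∈ s.powerset.filter (x₀ ∈ ·) := mem_filter.mpr ⟨mem_powerset_self s, hx₀⟩
  have hsmaller : ∀ S ∈ (s.powerset.filter (x₀ ∈ ·)).erase s,
      partitionCumulant e S * e (#s - #S) = c #S * e (#s - #S) := fun S hS => by
    obtain ⟨hne, hS⟩ := mem_erase.mp hS
    obtain ⟨hS, hx⟩ := mem_filter.mp hS
    rw [ih S ((mem_powerset.mp hS).ssubset_of_ne hne) ⟨x₀, hx⟩]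
  have hsum := (sum_partitionCumulant_mul hx₀ h0).trans (h.apply_card hx₀)
  rw [← add_sum_erase _ _ hmem, ← add_sum_erase _ _ hmem, sum_congr rfl hsmaller] at hsum
  simpa [h0] using hsum

end SetPartitionSum

section Existence

variable {R : Type*} [CommRing R] {e : ℕ → R}

/-- The cumulants of `e`, computed recursively; `recursiveCumulant e n` is the cumulant of order
`n + 1`. -/
def recursiveCumulant (e : ℕ → R) (n : ℕ) : R :=
  e (n + 1) - ∑ k : Fin n, (n.choose k : R) * recursiveCumulant e k * e (n - k)
  decreasing_by exact k.2

theorem hasCumulants_recursiveCumulant (h0 : e 0 = 1) :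
    HasCumulants e fun n => recursiveCumulant e (n - 1) := fun n => by
  have hrec : recursiveCumulant e n = e (n + 1) -
      ∑ k ∈ range n, (n.choose k : R) * recursiveCumulant e k * e (n - k) := by
    rw [recursiveCumulant, Fin.sum_univ_eq_sum_range fun k =>
      (n.choose k : R) * recursiveCumulant e k * e (n - k)]
  simp only [sum_range_succ, Nat.add_sub_cancel, Nat.sub_self, h0, hrec, Nat.choose_self]
  ring

theorem hasCumulants_setPartition (h0 : e 0 = 1) : HasCumulants e fun n =>
    ∑ π : SetPartition n, partitionMoebius R #π.parts * ∏ V ∈ π.parts, e #V :=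
  (hasCumulants_recursiveCumulant h0).congr fun n => by
    have h := (hasCumulants_recursiveCumulant h0).partitionCumulant_eq h0
      (univ_nonempty (α := Fin (n + 1)))
    rwa [card_univ, Fintype.card_fin, eq_comm] at h

end Existence

/-! ### Coefficients, power sums and finite free cumulants -/

theorem esymm_eq_sum_powerSum {R : Type*} [CommRing R] (s : Multiset R) (n : ℕ) :
    ((n + 1 : ℕ) : R) * s.esymm (n + 1) =
      ∑ k ∈ range (n + 1), (-1) ^ k * (s.map (· ^ (k + 1))).sum * s.esymm (n - k) := by
  classical
  have hpsum : ∀ k, MvPolynomial.aeval (fun x : s => (x : R)) (MvPolynomial.psum s R k) =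
      (s.map (· ^ k)).sum := fun k => by
    conv_rhs => rw [← s.map_univ_coe, Multiset.map_map]
    simp only [MvPolynomial.psum, map_sum, map_pow, MvPolynomial.aeval_X]
    rfl
  have hnewton := congrArg (MvPolynomial.aeval fun x : s => (x : R))
    (MvPolynomial.mul_esymm_eq_sum s R (n + 1))
  simp only [map_mul, map_sum, map_pow, map_neg, map_one, map_natCast,
    MvPolynomial.aeval_esymm_eq_multiset_esymm, hpsum, s.map_univ_coe] at hnewton
  rw [hnewton, sum_filter, Nat.sum_antidiagonal_eq_sum_range_succ_mk, sum_range_succ,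
    if_neg (lt_irrefl _), add_zero, ← sum_range_reflect, mul_sum]
  refine sum_congr rfl fun k hk => ?_
  have hkn : k ≤ n := Nat.lt_succ_iff.mp (mem_range.mp hk)
  have hesymm : n + 1 - 1 - k = n - k := by omega
  have hpow : n + 1 - (n - k) = k + 1 := by omega
  have hsign : n + 1 + 1 + (n - k) = 2 * (n + 1 - k) + k := by omega
  simp only [hesymm, hpow]
  rw [if_pos (by omega), ← mul_assoc, ← mul_assoc, ← pow_add, hsign, pow_add, pow_mul,
    neg_one_sq, one_pow, one_mul, mul_right_comm]

/-- The weights `(-1)^{k-1} d u_k`, which turn the moments `u` of the roots of a polynomial of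
degree `d` into the permutation weights that generate its coefficients. -/
def momentWeight (d : ℕ) (u : ℕ → ℝ) (k : ℕ) : ℝ := (-1) ^ (k - 1) * (d * u k)

/-- The weights `(-1/d)^{k-1} u_k`, which turn the finite free cumulants `u` of a polynomial of
degree `d` into the permutation weights that generate its normalized coefficients. -/
noncomputable def cumulantWeight (d : ℕ) (u : ℕ → ℝ) (k : ℕ) : ℝ := (-(1 / d)) ^ (k - 1) * u k

section Polynomial

variable {d n : ℕ} {p q : ℝ[X]}

theorem choose_mul_normCoeff (hn : n ≤ d) :
    d.choose n * normCoeff d p n = (-1) ^ n * p.coeff (d - n) :=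
  mul_div_cancel₀ _ (Nat.cast_ne_zero.mpr (Nat.choose_pos hn).ne')

theorem normCoeff_zero (hp : p.Monic) (hpd : p.natDegree = d) : normCoeff d p 0 = 1 := by
  simp [normCoeff, ← hpd, hp.coeff_natDegree]

theorem normCoeff_of_lt (hn : d < n) : normCoeff d p n = 0 := by
  simp [normCoeff, Nat.choose_eq_zero_of_lt hn]

theorem ofReal_choose_mul_normCoeff (hp : p.Monic) (hpd : p.natDegree = d) (n : ℕ) :
    ((d.choose n * normCoeff d p n : ℝ) : ℂ) = (p.aroots ℂ).esymm n := by
  have hsplits := IsAlgClosed.splits (p.map (algebraMap ℝ ℂ))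
  have hdeg : (p.map (algebraMap ℝ ℂ)).natDegree = d := by rw [hp.natDegree_map, hpd]
  rcases le_or_gt n d with hn | hn
  · have hcoeff : ((p.coeff (d - n) : ℝ) : ℂ) = (-1) ^ n * (p.aroots ℂ).esymm n := by
      have h := coeff_eq_esymm_roots_of_splits hsplits (k := d - n) (hdeg ▸ Nat.sub_le _ _)
      rwa [hdeg, (hp.map _).leadingCoeff, one_mul, Nat.sub_sub_self hn, coeff_map] at h
    rw [choose_mul_normCoeff hn, Complex.ofReal_mul, hcoeff, Complex.ofReal_pow, ← mul_assoc,
      ← mul_pow]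
    simp
  · have hcard : Multiset.card (p.aroots ℂ) < n :=
      (splits_iff_card_roots.mp hsplits).trans hdeg |>.trans_lt hn
    rw [normCoeff_of_lt hn, Multiset.esymm, Multiset.powersetCard_eq_empty _ hcard]
    simp

theorem ofReal_mul_rootMoment (hd : d ≠ 0) (p : ℝ[X]) (n : ℕ) :
    ((d * rootMoment d p n : ℝ) : ℂ) = ((p.aroots ℂ).map (· ^ n)).sum := by
  rw [rootMoment, mul_div_cancel₀ _ (Nat.cast_ne_zero.mpr hd)]
  exact Complex.ext rfl (by rw [sum_aroots_pow_im, Complex.ofReal_im])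

theorem hasCumulants_factorial_mul_normCoeff (hd : d ≠ 0) (hp : p.Monic) (hpd : p.natDegree = d) :
    HasCumulants (fun n => (n.factorial : ℝ) * (d.choose n * normCoeff d p n))
      (fun n => ((n - 1).factorial : ℝ) * momentWeight d (rootMoment d p) n) := by
  intro n
  apply Complex.ofReal_injective
  have hnewton := esymm_eq_sum_powerSum (p.aroots ℂ) n
  simp only [← ofReal_choose_mul_normCoeff hp hpd, ← ofReal_mul_rootMoment hd] at hnewton
  rw [Complex.ofReal_mul, Nat.factorial_succ, Complex.ofReal_natCast, Nat.cast_mul,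
    mul_comm (((n + 1 : ℕ) : ℂ)), mul_assoc, hnewton, mul_sum, Complex.ofReal_sum]
  refine sum_congr rfl fun k hk => ?_
  simp only [momentWeight, Nat.add_sub_cancel]
  rw [← Nat.choose_mul_factorial_mul_factorial (Nat.lt_succ_iff.mp (mem_range.mp hk))]
  push_cast
  ring

theorem permSum_momentWeight (hd : d ≠ 0) (hp : p.Monic) (hpd : p.natDegree = d) (n : ℕ) :
    permSum (Fin n) (momentWeight d (rootMoment d p)) =
      n.factorial * (d.choose n * normCoeff d p n) :=
  (hasCumulants_permSum _).moment_unique (by simp [permSum_fin_zero, normCoeff_zero hp hpd])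
    (hasCumulants_factorial_mul_normCoeff hd hp hpd) n

theorem hasCumulants_normCoeff (hd : d ≠ 0) (hp : p.Monic) (hpd : p.natDegree = d) :
    HasCumulants (normCoeff d p)
      (fun n => ((n - 1).factorial : ℝ) * cumulantWeight d (finiteFreeCumulant d p) n) := by
  refine (hasCumulants_setPartition (normCoeff_zero hp hpd)).congr fun n => ?_
  have hd' : (d : ℝ) ≠ 0 := Nat.cast_ne_zero.mpr hd
  have hn' : (n.factorial : ℝ) ≠ 0 := Nat.cast_ne_zero.mpr n.factorial_ne_zero
  have hpow : (-(1 / (d : ℝ))) ^ n * (-(d : ℝ)) ^ n = 1 := by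
    rw [← mul_pow, neg_mul_neg, one_div_mul_cancel hd', one_pow]
  rw [cumulantWeight, finiteFreeCumulant, Nat.add_sub_cancel, ← mul_assoc (_ ^ n),
    ← mul_div_assoc, hpow, ← mul_assoc, mul_one_div_cancel hn', one_mul]
  rfl

theorem permSum_cumulantWeight (hd : d ≠ 0) (hp : p.Monic) (hpd : p.natDegree = d) (n : ℕ) :
    permSum (Fin n) (cumulantWeight d (finiteFreeCumulant d p)) = normCoeff d p n :=
  (hasCumulants_permSum _).moment_unique (by rw [permSum_fin_zero, normCoeff_zero hp hpd])
    (hasCumulants_normCoeff hd hp hpd) n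

/-! ### Finite free multiplicative convolution -/

theorem coeff_finiteFreeMul {k : ℕ} (hk : k ≤ d) :
    (finiteFreeMul d p q).coeff (d - k) =
      (-1) ^ k * (d.choose k : ℝ) * (normCoeff d p k * normCoeff d q k) := by
  rw [finiteFreeMul, finsetSum_coeff, sum_eq_single k]
  · rw [coeff_C_mul, coeff_X_pow_self, mul_one]
  · intro j hj hjk
    have := mem_range.mp hj
    rw [coeff_C_mul, coeff_X_pow, if_neg (by omega), mul_zero]
  · exact fun h => absurd (mem_range.mpr (Nat.lt_succ_of_le hk)) h

theorem normCoeff_finiteFreeMul (d : ℕ) (p q : ℝ[X]) (n : ℕ) :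
    normCoeff d (finiteFreeMul d p q) n = normCoeff d p n * normCoeff d q n := by
  rcases le_or_gt n d with hn | hn
  · have hchoose : (d.choose n : ℝ) ≠ 0 := Nat.cast_ne_zero.mpr (Nat.choose_pos hn).ne'
    apply mul_left_cancel₀ hchoose
    rw [choose_mul_normCoeff hn, coeff_finiteFreeMul hn, mul_assoc ((-1) ^ n),
      ← mul_assoc ((-1) ^ n), ← mul_pow]
    simp
  · simp only [normCoeff_of_lt hn, mul_zero]

theorem natDegree_finiteFreeMul_le : (finiteFreeMul d p q).natDegree ≤ d :=
  natDegree_sum_le_of_forall_le _ _ fun _ _ =>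
    (natDegree_C_mul_X_pow_le _ _).trans (Nat.sub_le _ _)

theorem coeff_finiteFreeMul_self (hp : p.Monic) (hpd : p.natDegree = d) (hq : q.Monic)
    (hqd : q.natDegree = d) : (finiteFreeMul d p q).coeff d = 1 := by
  simpa [normCoeff_zero hp hpd, normCoeff_zero hq hqd] using
    coeff_finiteFreeMul (p := p) (q := q) (Nat.zero_le d)

theorem monic_finiteFreeMul (hp : p.Monic) (hpd : p.natDegree = d) (hq : q.Monic)
    (hqd : q.natDegree = d) : (finiteFreeMul d p q).Monic :=
  monic_of_natDegree_le_of_coeff_eq_one d natDegree_finiteFreeMul_le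
    (coeff_finiteFreeMul_self hp hpd hq hqd)

theorem natDegree_finiteFreeMul (hp : p.Monic) (hpd : p.natDegree = d) (hq : q.Monic)
    (hqd : q.natDegree = d) : (finiteFreeMul d p q).natDegree = d :=
  natDegree_finiteFreeMul_le.antisymm <| le_natDegree_of_ne_zero <| by
    rw [coeff_finiteFreeMul_self hp hpd hq hqd]
    exact one_ne_zero

theorem transitiveSum_momentWeight_cumulantWeight (hd : d ≠ 0) (hp : p.Monic)
    (hpd : p.natDegree = d) (hq : q.Monic) (hqd : q.natDegree = d) (n : ℕ) :
    transitiveSum (Fin (n + 1)) (momentWeight d (rootMoment d p))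
        (cumulantWeight d (finiteFreeCumulant d q)) =
      n.factorial * momentWeight d (rootMoment d (finiteFreeMul d p q)) (n + 1) := by
  have hpairs := hasCumulants_transitiveSum (momentWeight d (rootMoment d p))
    (cumulantWeight d (finiteFreeCumulant d q))
  have hmul := hasCumulants_factorial_mul_normCoeff hd (monic_finiteFreeMul hp hpd hq hqd)
    (natDegree_finiteFreeMul hp hpd hq hqd)
  simp only [permSum_momentWeight hd hp hpd, permSum_cumulantWeight hd hq hqd] at hpairs
  simp only [normCoeff_finiteFreeMul, ← mul_assoc] at hpairs hmul
  exact hpairs.cumulant_unique (by simp [normCoeff_zero hp hpd, normCoeff_zero hq hqd]) hmul n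

theorem transitiveSum_cumulantWeight_cumulantWeight (hd : d ≠ 0) (hp : p.Monic)
    (hpd : p.natDegree = d) (hq : q.Monic) (hqd : q.natDegree = d) (n : ℕ) :
    transitiveSum (Fin (n + 1)) (cumulantWeight d (finiteFreeCumulant d p))
        (cumulantWeight d (finiteFreeCumulant d q)) =
      n.factorial * cumulantWeight d (finiteFreeCumulant d (finiteFreeMul d p q)) (n + 1) := by
  have hpairs := hasCumulants_transitiveSum (cumulantWeight d (finiteFreeCumulant d p))
    (cumulantWeight d (finiteFreeCumulant d q))
  have hmul := hasCumulants_normCoeff hd (monic_finiteFreeMul hp hpd hq hqd)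
    (natDegree_finiteFreeMul hp hpd hq hqd)
  simp only [permSum_cumulantWeight hd hp hpd, permSum_cumulantWeight hd hq hqd] at hpairs
  rw [funext (normCoeff_finiteFreeMul d p q)] at hmul
  exact hpairs.cumulant_unique (by simp [normCoeff_zero hp hpd, normCoeff_zero hq hqd]) hmul n

theorem rootMoment_X_sub_one_pow (hd : d ≠ 0) (n : ℕ) : rootMoment d ((X - C 1) ^ d) n = 1 := by
  have hd' : (d : ℝ) ≠ 0 := Nat.cast_ne_zero.mpr hd
  rw [rootMoment_of_splits d (Splits.pow (Splits.X_sub_C 1) d), roots_pow, roots_X_sub_C]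
  simp [Multiset.map_nsmul, Multiset.sum_nsmul, hd']

theorem normCoeff_X_sub_one_pow (hn : n ≤ d) : normCoeff d ((X - C 1) ^ d) n = 1 := by
  have hchoose : (d.choose n : ℝ) ≠ 0 := Nat.cast_ne_zero.mpr (Nat.choose_pos hn).ne'
  apply mul_left_cancel₀ hchoose
  rw [choose_mul_normCoeff hn, sub_eq_add_neg, ← C_neg, coeff_X_add_C_pow, Nat.sub_sub_self hn,
    Nat.choose_symm hn, ← mul_assoc, ← mul_pow]
  simp

theorem finiteFreeMul_X_sub_one_pow (hqd : q.natDegree = d) :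
    finiteFreeMul d ((X - C 1) ^ d) q = q := by
  ext k
  rcases le_or_gt k d with hk | hk
  · obtain ⟨j, hj, rfl⟩ : ∃ j ≤ d, k = d - j := ⟨d - k, Nat.sub_le _ _, (Nat.sub_sub_self hk).symm⟩
    rw [coeff_finiteFreeMul hj, normCoeff_X_sub_one_pow hj, one_mul, mul_assoc,
      choose_mul_normCoeff hj, ← mul_assoc, ← mul_pow]
    simp
  · rw [coeff_eq_zero_of_natDegree_lt (natDegree_finiteFreeMul_le.trans_lt hk),
      coeff_eq_zero_of_natDegree_lt (hqd.trans_lt hk)]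

end Polynomial

/-! ### The genus expansion -/

/-- `1/(n-1)! ∑ (-ε)^{n+1-#α-#β} u_α v_β` over the pairs `(α, β)` of permutations of `n` points
that generate a transitive group, `#` being the number of cycles. For `ε = 1/d` it expresses the
moments and the finite free cumulants of `p ⊠_d q` through those of `p` and `q`. By the genus
inequality the subtractions in the exponent are not truncated. -/
noncomputable def genusSum (n : ℕ) (ε : ℝ) (u v : ℕ → ℝ) : ℝ :=
  1 / ((n - 1).factorial : ℝ) * ∑ a ∈ transitivePairs (Fin n),
    (-ε) ^ (n + 1 - numClasses (cycleRel a.1) - numClasses (cycleRel a.2)) *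
      (classProd u (cycleRel a.1) * classProd v (cycleRel a.2))

theorem numClasses_add_add_le_of_mem_transitivePairs {X : Type*} [Fintype X] [DecidableEq X]
    [Nonempty X] {a : Equiv.Perm X × Equiv.Perm X} (h : a ∈ transitivePairs X) :
    numClasses (cycleRel a.1) + numClasses (cycleRel a.2) + numClasses (cycleRel (a.1 * a.2)) ≤
      Fintype.card X + 2 := by
  have hgenus := numClasses_add_numClasses_mul_le a.1 a.2
  rwa [mem_transitivePairs.mp h, numClasses_top, Nat.card_eq_fintype_card] at hgenus

theorem numClasses_add_le_of_mem_transitivePairs {X : Type*} [Fintype X] [DecidableEq X]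
    [Nonempty X] {a : Equiv.Perm X × Equiv.Perm X} (h : a ∈ transitivePairs X) :
    numClasses (cycleRel a.1) + numClasses (cycleRel a.2) ≤ Fintype.card X + 1 := by
  have hgenus := numClasses_add_add_le_of_mem_transitivePairs h
  have hpos := numClasses_pos (cycleRel (a.1 * a.2))
  omega

theorem transitiveSum_cumulantWeight_eq_genusSum (d n : ℕ) (u v : ℕ → ℝ) :
    transitiveSum (Fin (n + 1)) (cumulantWeight d u) (cumulantWeight d v) =
      (-(1 / (d : ℝ))) ^ n * n.factorial * genusSum (n + 1) (1 / d) u v := by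
  have hn' : (n.factorial : ℝ) ≠ 0 := Nat.cast_ne_zero.mpr n.factorial_ne_zero
  rw [genusSum, Nat.add_sub_cancel, mul_assoc, ← mul_assoc (n.factorial : ℝ),
    mul_one_div_cancel hn', one_mul, mul_sum, transitiveSum]
  refine sum_congr rfl fun a ha => ?_
  have hle := numClasses_add_le_of_mem_transitivePairs ha
  have hleft := numClasses_le_card (cycleRel a.1)
  have hright := numClasses_le_card (cycleRel a.2)
  rw [Nat.card_eq_fintype_card] at hleft hright
  have hpow : (-(1 / (d : ℝ))) ^ n *
      (-(1 / (d : ℝ))) ^ (n + 1 + 1 - numClasses (cycleRel a.1) - numClasses (cycleRel a.2)) =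
      (-(1 / (d : ℝ))) ^ (n + 1 - numClasses (cycleRel a.1)) *
      (-(1 / (d : ℝ))) ^ (n + 1 - numClasses (cycleRel a.2)) := by
    rw [Fintype.card_fin] at hle hleft hright
    rw [← pow_add, ← pow_add]
    congr 1
    omega
  have hweight (w : ℕ → ℝ) : cumulantWeight d w = fun k => (-(1 / (d : ℝ))) ^ (k - 1) * w k := rfl
  rw [hweight, hweight, classProd_pow_pred_mul, classProd_pow_pred_mul, Fintype.card_fin]
  linear_combination -(classProd u (cycleRel a.1) * classProd v (cycleRel a.2)) * hpow

theorem classProd_momentWeight {d : ℕ} (hd : d ≠ 0) {X : Type*} [Fintype X] (u : ℕ → ℝ)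
    (r : Setoid X) : classProd (momentWeight d u) r =
      (d : ℝ) ^ Fintype.card X * classProd (cumulantWeight d u) r := by
  rw [← classProd_pow (d : ℝ) r, ← classProd_mul]
  refine classProd_congr (fun k hk => ?_) r
  obtain ⟨k, rfl⟩ : ∃ j, k = j + 1 := ⟨k - 1, (Nat.sub_add_cancel hk).symm⟩
  have hpow : (d : ℝ) ^ k * (-(1 / (d : ℝ))) ^ k = (-1) ^ k := by
    rw [← mul_pow, mul_neg, mul_one_div_cancel (Nat.cast_ne_zero.mpr hd)]
  rw [momentWeight, cumulantWeight, Nat.add_sub_cancel, ← hpow]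
  ring

theorem transitiveSum_momentWeight {d : ℕ} (hd : d ≠ 0) (n : ℕ) (u v : ℕ → ℝ) :
    transitiveSum (Fin n) (momentWeight d u) v =
      (d : ℝ) ^ n * transitiveSum (Fin n) (cumulantWeight d u) v := by
  simp only [transitiveSum, classProd_momentWeight hd, mul_sum, mul_assoc, Fintype.card_fin]

section Expansion

variable {d : ℕ} {p q : ℝ[X]}

theorem finiteFreeCumulant_finiteFreeMul (hd : d ≠ 0) (hp : p.Monic) (hpd : p.natDegree = d)
    (hq : q.Monic) (hqd : q.natDegree = d) (n : ℕ) :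
    finiteFreeCumulant d (finiteFreeMul d p q) (n + 1) =
      genusSum (n + 1) (1 / d) (finiteFreeCumulant d p) (finiteFreeCumulant d q) := by
  have hd' : (d : ℝ) ≠ 0 := Nat.cast_ne_zero.mpr hd
  have hn' : (n.factorial : ℝ) ≠ 0 := Nat.cast_ne_zero.mpr n.factorial_ne_zero
  have hpow : (-(1 / (d : ℝ))) ^ n ≠ 0 := pow_ne_zero _ (neg_ne_zero.mpr (one_div_ne_zero hd'))
  have h := transitiveSum_cumulantWeight_cumulantWeight hd hp hpd hq hqd n
  rw [transitiveSum_cumulantWeight_eq_genusSum, cumulantWeight, Nat.add_sub_cancel] at h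
  refine mul_left_cancel₀ (mul_ne_zero hpow hn') ?_
  linear_combination -h

theorem rootMoment_finiteFreeMul (hd : d ≠ 0) (hp : p.Monic) (hpd : p.natDegree = d)
    (hq : q.Monic) (hqd : q.natDegree = d) (n : ℕ) :
    rootMoment d (finiteFreeMul d p q) (n + 1) =
      genusSum (n + 1) (1 / d) (rootMoment d p) (finiteFreeCumulant d q) := by
  have hd' : (d : ℝ) ≠ 0 := Nat.cast_ne_zero.mpr hd
  have hn' : (n.factorial : ℝ) ≠ 0 := Nat.cast_ne_zero.mpr n.factorial_ne_zero
  have hsign : (-1 : ℝ) ^ n * d ≠ 0 := mul_ne_zero (pow_ne_zero _ (by norm_num)) hd'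
  have hpow : (d : ℝ) ^ (n + 1) * (-(1 / (d : ℝ))) ^ n = (-1) ^ n * d := by
    rw [pow_succ', mul_assoc, ← mul_pow, mul_neg, mul_one_div_cancel hd', mul_comm]
  have h := transitiveSum_momentWeight_cumulantWeight hd hp hpd hq hqd n
  rw [transitiveSum_momentWeight hd, transitiveSum_cumulantWeight_eq_genusSum, momentWeight,
    Nat.add_sub_cancel, ← mul_assoc, ← mul_assoc, hpow] at h
  refine mul_left_cancel₀ (mul_ne_zero hn' hsign) ?_
  linear_combination -h

theorem rootMoment_eq_genusSum (hd : d ≠ 0) (hq : q.Monic) (hqd : q.natDegree = d) (n : ℕ) :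
    rootMoment d q (n + 1) = genusSum (n + 1) (1 / d) (fun _ => 1) (finiteFreeCumulant d q) := by
  have hmonic : ((X - C 1 : ℝ[X]) ^ d).Monic := (monic_X_sub_C 1).pow d
  have hdeg : ((X - C 1 : ℝ[X]) ^ d).natDegree = d := by
    rw [(monic_X_sub_C (1 : ℝ)).natDegree_pow, natDegree_X_sub_C, mul_one]
  have h := rootMoment_finiteFreeMul hd hmonic hdeg hq hqd n
  rwa [finiteFreeMul_X_sub_one_pow hqd, funext (rootMoment_X_sub_one_pow hd)] at h

end Expansion

/-! ### Factorizations of a permutation -/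

section Factors

theorem permCongr_inv_mul {X Y : Type*} (e : X ≃ Y) (α g : Equiv.Perm X) :
    (e.permCongr α)⁻¹ * e.permCongr g = e.permCongr (α⁻¹ * g) := by
  simp only [← Equiv.permCongrHom_coe, map_mul, map_inv]

variable {R X Y : Type*} [CommRing R] [Fintype X] [DecidableEq X] [Fintype Y] [DecidableEq Y]

open Classical in
/-- The left factors `α` of the factorizations `g = αβ` for which `α` and `g` generate a transitive
group and `α` and `β` together have `N` cycles. -/
noncomputable def factors (N : ℕ) (g : Equiv.Perm X) : Finset (Equiv.Perm X) :=
  univ.filter fun α => cycleRel α ⊔ cycleRel g = ⊤ ∧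
    numClasses (cycleRel α) + numClasses (cycleRel (α⁻¹ * g)) = N

theorem mem_factors {N : ℕ} {g α : Equiv.Perm X} : α ∈ factors N g ↔ cycleRel α ⊔ cycleRel g = ⊤ ∧
    numClasses (cycleRel α) + numClasses (cycleRel (α⁻¹ * g)) = N := by
  simp only [factors, mem_filter, mem_univ, true_and]

/-- `∑ u_α v_β` over the factorizations `g = αβ` whose left factor lies in `factors N g`. -/
noncomputable def factorSum (N : ℕ) (u v : ℕ → R) (g : Equiv.Perm X) : R :=
  ∑ α ∈ factors N g, classProd u (cycleRel α) * classProd v (cycleRel (α⁻¹ * g))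

theorem factorSum_permCongr (e : X ≃ Y) (N : ℕ) (u v : ℕ → R) (g : Equiv.Perm X) :
    factorSum N u v (e.permCongr g) = factorSum N u v g := by
  refine (sum_equiv e.permCongr (fun α => ?_) fun α _ => ?_).symm
  · rw [mem_factors, mem_factors, permCongr_inv_mul, cycleRel_sup_permCongr_eq_top_iff,
      numClasses_permCongr, numClasses_permCongr]
  · rw [permCongr_inv_mul, classProd_permCongr, classProd_permCongr]

theorem factorSum_comm (N : ℕ) (u v : ℕ → R) (g : Equiv.Perm X) :
    factorSum N u v g = factorSum N v u g := by
  have hconj (α : Equiv.Perm X) : (α⁻¹ * g)⁻¹ * g = Equiv.permCongr g⁻¹ α := by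
    rw [mul_inv_rev, inv_inv]
    rfl
  refine sum_equiv ((Equiv.inv _).trans (Equiv.mulRight g)) (fun α => ?_) fun α _ => ?_
  · simp only [Equiv.trans_apply, Equiv.inv_apply, Equiv.coe_mulRight, mem_factors]
    rw [cycleRel_mul_sup_right, cycleRel_inv, hconj, numClasses_permCongr, add_comm]
  · simp only [Equiv.trans_apply, Equiv.inv_apply, Equiv.coe_mulRight]
    rw [hconj, classProd_permCongr, mul_comm]

theorem sum_transitivePairs_eq_sum_factorSum (N : ℕ) (u v : ℕ → R) :
    ∑ a ∈ transitivePairs X with numClasses (cycleRel a.1) + numClasses (cycleRel a.2) = N,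
      classProd u (cycleRel a.1) * classProd v (cycleRel a.2) =
        ∑ g : Equiv.Perm X, factorSum N u v g := by
  simp only [factorSum]
  rw [sum_sigma']
  refine sum_bij' (fun a _ => ⟨a.1 * a.2, a.1⟩) (fun c _ => (c.2, c.2⁻¹ * c.1)) ?_ ?_ ?_ ?_ ?_
  · rintro ⟨α, β⟩ h
    simpa only [mem_filter, mem_transitivePairs, mem_sigma, mem_univ, true_and, mem_factors,
      inv_mul_cancel_left, cycleRel_sup_mul_left] using h
  · rintro ⟨g, α⟩ h
    simp only [mem_sigma, mem_univ, true_and, mem_factors] at h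
    rwa [mem_filter, mem_transitivePairs, ← cycleRel_sup_mul_left, mul_inv_cancel_left]
  · simp only [inv_mul_cancel_left, implies_true]
  · simp only [mul_inv_cancel_left, implies_true]
  · simp only [inv_mul_cancel_left, implies_true]

variable {N : ℕ} {g : Equiv.Perm X}

theorem neg_one_pow_of_mem_factors {α : Equiv.Perm X} (h : α ∈ factors N g) :
    (-1 : ℤˣ) ^ N = (-1) ^ (Fintype.card X + numClasses (cycleRel g)) := by
  obtain ⟨-, hN⟩ := mem_factors.mp h
  rw [← hN, pow_add, pow_add, neg_one_pow_numClasses, neg_one_pow_numClasses,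
    neg_one_pow_numClasses, Equiv.Perm.sign_mul, Equiv.Perm.sign_inv,
    mul_mul_mul_comm, Int.units_mul_self, one_mul]
  simp only [← mul_assoc, Int.units_mul_self, one_mul]

variable [Nonempty X]

theorem add_numClasses_le_of_mem_factors {α : Equiv.Perm X} (h : α ∈ factors N g) :
    N + numClasses (cycleRel g) ≤ Fintype.card X + 2 := by
  obtain ⟨htrans, hN⟩ := mem_factors.mp h
  have hgenus := numClasses_add_numClasses_mul_le α (α⁻¹ * g)
  rw [← cycleRel_sup_mul_left, mul_inv_cancel_left, htrans, numClasses_top,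
    Nat.card_eq_fintype_card] at hgenus
  omega

theorem factorSum_card_add_one_eq_zero (hg : cycleRel g ≠ ⊤) (u v : ℕ → R) :
    factorSum (Fintype.card X + 1) u v g = 0 := by
  suffices h : factors (Fintype.card X + 1) g = ∅ by rw [factorSum, h, sum_empty]
  refine eq_empty_of_forall_notMem fun α hα => hg (numClasses_eq_one_iff.mp ?_)
  have hle := add_numClasses_le_of_mem_factors hα
  have hpos := numClasses_pos (cycleRel g)
  omega

theorem factorSum_card_eq_zero (hg : numClasses (cycleRel g) ≠ 2) (u v : ℕ → R) :
    factorSum (Fintype.card X) u v g = 0 := by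
  suffices h : factors (Fintype.card X) g = ∅ by rw [factorSum, h, sum_empty]
  refine eq_empty_of_forall_notMem fun α hα => ?_
  have hle := add_numClasses_le_of_mem_factors hα
  have hpos := numClasses_pos (cycleRel g)
  have hone : numClasses (cycleRel g) = 1 := by omega
  -- A single cycle is excluded by the sign of the permutation.
  have hsign := neg_one_pow_of_mem_factors hα
  rw [hone, pow_succ] at hsign
  simp at hsign

end Factors

section LongCycles

variable {R X : Type*} [Fintype X] [DecidableEq X]

theorem card_longCycles_of_nonempty [Nonempty X] :
    #(longCycles X) = (Fintype.card X - 1).factorial := by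
  obtain ⟨n, hn⟩ := Nat.exists_eq_add_one.mpr (Fintype.card_pos (α := X))
  rw [hn, Nat.add_sub_cancel, ← card_longCycles]
  refine card_equiv (Fintype.equivFinOfCardEq hn).permCongr fun σ => ?_
  simpa only [mem_longCycles, sup_idem] using
    (cycleRel_sup_permCongr_eq_top_iff _ (α := σ) (β := σ)).symm

theorem sum_perm_eq_sum_orbit [AddCommMonoid R] (x₀ : X) (f : Equiv.Perm X → R) :
    ∑ σ, f σ = ∑ S : Finset X with x₀ ∈ S,
      ∑ a ∈ longCycles {x // x ∈ S}, ∑ b : Equiv.Perm {x // x ∉ S}, f (a.subtypeCongr b) := by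
  -- Restrict the second permutation of a pair to be the identity.
  have h := sum_perm_prod_perm_eq_sum_orbit x₀ fun a => if a.2 = 1 then f a.1 else 0
  rw [Fintype.sum_prod_type] at h
  simp only [sum_ite_eq', mem_univ, if_true] at h
  rw [h]
  refine sum_congr rfl fun S _ => ?_
  have subtypeCongr_eq_one (a : Equiv.Perm {x // x ∈ S}) (b : Equiv.Perm {x // x ∉ S}) :
      a.subtypeCongr b = 1 ↔ a = 1 ∧ b = 1 :=
    (map_eq_one_iff (Equiv.Perm.subtypeCongrHom (· ∈ S))
      (Equiv.Perm.subtypeCongrHom_injective (· ∈ S)) (x := (a, b))).trans Prod.mk_eq_one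
  simp only [transitivePairs, longCycles, sum_filter, Fintype.sum_prod_type, subtypeCongr_eq_one]
  refine sum_congr rfl fun a _ => ?_
  rw [sum_eq_single 1 (fun b _ hb => by simp [hb]) fun h1 => absurd (mem_univ _) h1, cycleRel_one,
    sup_bot_eq]
  simp

theorem exists_permCongr_eq_finRotate {X : Type*} [Fintype X] {k : ℕ} (hk : Fintype.card X = k)
    {g : Equiv.Perm X} (hg : cycleRel g = ⊤) : ∃ e : X ≃ Fin k, e.permCongr g = finRotate k := by
  let e₀ := Fintype.equivFinOfCardEq hk
  classical
  match k, hk, e₀ with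
  | 0, _, e₀ => exact ⟨e₀, Subsingleton.elim _ _⟩
  | 1, _, e₀ => exact ⟨e₀, Subsingleton.elim _ _⟩
  | k + 2, _, e₀ =>
    have htop : cycleRel (e₀.permCongr g) = ⊤ := by
      simpa only [sup_idem] using cycleRel_sup_permCongr_eq_top e₀ (α := g) (β := g) (by simpa)
    have hsame : ∀ x y, (e₀.permCongr g).SameCycle x y := fun x y =>
      (htop ▸ trivial : cycleRel (e₀.permCongr g) x y)
    have hmove : ∀ x, e₀.permCongr g x ≠ x := fun x hx => by
      obtain ⟨y, hy⟩ := exists_ne x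
      exact hy ((hsame x y).eq_of_left hx).symm
    have hcycle : (e₀.permCongr g).IsCycle := ⟨0, hmove 0, fun y _ => hsame 0 y⟩
    have hsupp : (e₀.permCongr g).support = univ := by
      ext x
      simpa only [Equiv.Perm.mem_support, mem_univ, iff_true] using hmove x
    obtain ⟨c, hc⟩ := isConj_iff.mp <|
      hcycle.isConj (isCycle_finRotate (n := k)) (by rw [hsupp, support_finRotate])
    refine ⟨e₀.trans c, ?_⟩
    rw [← hc]
    ext x
    simp only [Equiv.permCongr_def, Equiv.Perm.mul_apply, Equiv.Perm.inv_def, Equiv.trans_apply,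
      Equiv.symm_trans_apply]

end LongCycles

section Annular

variable {R : Type*} [CommRing R]

theorem sum_factorSum_eq_factorial_mul (n : ℕ) (u v : ℕ → R) :
    ∑ g : Equiv.Perm (Fin (n + 1)), factorSum (n + 2) u v g =
      n.factorial * factorSum (n + 2) u v (finRotate (n + 1)) := by
  have hzero : ∀ g ∈ univ, g ∉ longCycles (Fin (n + 1)) → factorSum (n + 2) u v g = 0 :=
    fun g _ hg => by
      simpa only [Fintype.card_fin] using
        factorSum_card_add_one_eq_zero (fun h => hg (mem_longCycles.mpr h)) u v
  have hconst : ∀ g ∈ longCycles (Fin (n + 1)),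
      factorSum (n + 2) u v g = factorSum (n + 2) u v (finRotate (n + 1)) := fun g hg => by
    obtain ⟨e, he⟩ :=
      exists_permCongr_eq_finRotate (Fintype.card_fin (n + 1)) (mem_longCycles.mp hg)
    rw [← he, factorSum_permCongr]
  rw [← sum_subset (subset_univ (longCycles (Fin (n + 1)))) hzero, sum_congr rfl hconst, sum_const,
    card_longCycles, nsmul_eq_mul]

section

variable {X : Type*} [DecidableEq X] {S : Finset X} {a : Equiv.Perm {x // x ∈ S}}
  {b : Equiv.Perm {x // x ∉ S}}

theorem permCongr_subtypeCongr_eq_annularRotate {t s : ℕ}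
    {e₁ : {x // x ∈ S} ≃ Fin t} {e₂ : {x // x ∉ S} ≃ Fin s} (h₁ : e₁.permCongr a = finRotate t)
    (h₂ : e₂.permCongr b = finRotate s) :
    ((Equiv.sumCompl (· ∈ S)).symm.trans ((e₁.sumCongr e₂).trans finSumFinEquiv)).permCongr
      (a.subtypeCongr b) = annularRotate t s := by
  rw [annularRotate, ← h₁, ← h₂]
  ext x
  obtain ⟨y | y, rfl⟩ := finSumFinEquiv.surjective x
  · simp [Equiv.permCongr_def]
  · simp [Equiv.permCongr_def, (e₂.symm y).2]

variable [Fintype X]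

theorem factorSum_subtypeCongr (ha : cycleRel a = ⊤) (hb : cycleRel b = ⊤) (N : ℕ)
    (u v : ℕ → R) :
    factorSum N u v (a.subtypeCongr b) = factorSum N u v (annularRotate #S #Sᶜ) := by
  have hSc : Fintype.card {x // x ∉ S} = #Sᶜ := by
    rw [Fintype.card_subtype_compl, Fintype.card_coe, card_compl]
  obtain ⟨e₁, h₁⟩ := exists_permCongr_eq_finRotate (Fintype.card_coe S) ha
  obtain ⟨e₂, h₂⟩ := exists_permCongr_eq_finRotate hSc hb
  rw [← permCongr_subtypeCongr_eq_annularRotate h₁ h₂, factorSum_permCongr]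

theorem sum_longCycles_factorSum_subtypeCongr (hS : S.Nonempty) (u v : ℕ → R) :
    ∑ a ∈ longCycles {x // x ∈ S}, ∑ b : Equiv.Perm {x // x ∉ S},
      factorSum (Fintype.card X) u v (a.subtypeCongr b) =
        if #Sᶜ = 0 then 0 else ((#S - 1).factorial : R) * ((#Sᶜ - 1).factorial *
          factorSum (#S + #Sᶜ) u v (annularRotate #S #Sᶜ)) := by
  have := hS.to_subtype
  have : Nonempty X := hS.to_type
  have hSc : Fintype.card {x // x ∉ S} = #Sᶜ := by
    rw [Fintype.card_subtype_compl, Fintype.card_coe, card_compl]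
  have hnumClasses {a : Equiv.Perm {x // x ∈ S}} (ha : a ∈ longCycles {x // x ∈ S})
      (b : Equiv.Perm {x // x ∉ S}) :
      numClasses (cycleRel (a.subtypeCongr b)) = 1 + numClasses (cycleRel b) := by
    rw [numClasses_subtypeCongr, mem_longCycles.mp ha, numClasses_top]
  split_ifs with hS0
  · refine sum_eq_zero fun a ha => sum_eq_zero fun b _ => factorSum_card_eq_zero ?_ u v
    have hle := numClasses_le_card (cycleRel b)
    rw [Nat.card_eq_fintype_card, hSc] at hle
    rw [hnumClasses ha]
    omega
  have : Nonempty {x // x ∉ S} := Fintype.card_pos_iff.mp (by omega)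
  have hzero : ∀ a ∈ longCycles {x // x ∈ S}, ∀ b ∈ univ, b ∉ longCycles {x // x ∉ S} →
      factorSum (Fintype.card X) u v (a.subtypeCongr b) = 0 := fun a ha b _ hb => by
    refine factorSum_card_eq_zero (fun h => hb (mem_longCycles.mpr ?_)) u v
    rw [hnumClasses ha] at h
    exact numClasses_eq_one_iff.mp (by omega)
  have hconst : ∀ a ∈ longCycles {x // x ∈ S}, ∑ b : Equiv.Perm {x // x ∉ S},
      factorSum (Fintype.card X) u v (a.subtypeCongr b) = (#Sᶜ - 1).factorial *
        factorSum (Fintype.card X) u v (annularRotate #S #Sᶜ) := fun a ha => by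
    rw [← sum_subset (subset_univ (longCycles {x // x ∉ S})) (hzero a ha),
      sum_congr rfl fun b hb =>
        factorSum_subtypeCongr (mem_longCycles.mp ha) (mem_longCycles.mp hb) _ u v,
      sum_const, card_longCycles_of_nonempty, hSc, nsmul_eq_mul]
  rw [sum_congr rfl hconst, sum_const, card_longCycles_of_nonempty, Fintype.card_coe, nsmul_eq_mul,
    ← card_add_card_compl S]

end

theorem factorSum_annularRotate_comm (t s : ℕ) (u v : ℕ → R) :
    factorSum (t + s) u v (annularRotate t s) = factorSum (s + t) u v (annularRotate s t) := by
  let e : Fin (t + s) ≃ Fin (s + t) :=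
    finSumFinEquiv.symm.trans ((Equiv.sumComm (Fin t) (Fin s)).trans finSumFinEquiv)
  have h : e.permCongr (annularRotate t s) = annularRotate s t := by
    ext x
    obtain ⟨y | y, rfl⟩ := finSumFinEquiv.surjective x <;>
      simp [e, Equiv.permCongr_def, annularRotate]
  rw [← h, factorSum_permCongr, add_comm s t]

/-- The pairs `(t, s)` with `t + s = n` and `t, s ≥ 1`. -/
abbrev posAntidiagonal (n : ℕ) : Finset (ℕ × ℕ) :=
  (antidiagonal n).filter (fun ts => 1 ≤ ts.1 ∧ 1 ≤ ts.2)

theorem sum_posAntidiagonal_succ (n : ℕ) (f : ℕ → ℕ → R) :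
    ∑ ts ∈ posAntidiagonal (n + 1), f ts.1 ts.2 = ∑ k ∈ range n, f (k + 1) (n - k) := by
  rw [posAntidiagonal, sum_filter, Nat.sum_antidiagonal_eq_sum_range_succ_mk, sum_range_succ',
    sum_range_succ]
  simp only [Nat.sub_self, Nat.add_sub_add_right]
  rw [if_neg (by omega), if_neg (by omega), add_zero, add_zero]
  refine sum_congr rfl fun k hk => if_pos ?_
  have := mem_range.mp hk
  omega

theorem sum_posAntidiagonal_swap (n : ℕ) (f : ℕ → ℕ → R) :
    ∑ ts ∈ posAntidiagonal n, f ts.1 ts.2 = ∑ ts ∈ posAntidiagonal n, f ts.2 ts.1 := by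
  refine sum_equiv (Equiv.prodComm ℕ ℕ) (fun ts => ?_) fun _ _ => rfl
  simp only [mem_filter, HasAntidiagonal.mem_antidiagonal, Equiv.prodComm_apply, Prod.fst_swap,
    Prod.snd_swap]
  omega

variable {K : Type*} [Field K] [CharZero K]

theorem sum_factorSum_eq_sum_annularRotate_div (n : ℕ) (u v : ℕ → K) :
    ∑ g : Equiv.Perm (Fin (n + 1)), factorSum (n + 1) u v g =
      n.factorial * ∑ ts ∈ posAntidiagonal (n + 1),
        factorSum (ts.1 + ts.2) u v (annularRotate ts.1 ts.2) / ts.2 := by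
  let F : ℕ → ℕ → K := fun t s => factorSum (t + s) u v (annularRotate t s)
  let G : ℕ → K := fun k => if n + 1 - k = 0 then 0 else
    ((k - 1).factorial : K) * ((n + 1 - k - 1).factorial * F k (n + 1 - k))
  have horbit : ∀ S ∈ univ.powerset.filter fun S : Finset (Fin (n + 1)) => 0 ∈ S,
      ∑ a ∈ longCycles {x // x ∈ S}, ∑ b : Equiv.Perm {x // x ∉ S},
        factorSum (n + 1) u v (a.subtypeCongr b) = G #S * 1 := fun S hS => by
    have h := sum_longCycles_factorSum_subtypeCongr ⟨0, (mem_filter.mp hS).2⟩ u v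
    rw [mul_one]
    rwa [card_compl, Fintype.card_fin] at h
  have hterm : ∀ k ∈ range n, (n.choose k : K) * G (k + 1) * 1 =
      n.factorial * (F (k + 1) (n - k) / (n - k : ℕ)) := fun k hk => by
    obtain ⟨j, rfl⟩ : ∃ j, n = k + (j + 1) := Nat.exists_eq_add_of_lt (mem_range.mp hk)
    have hchoose : (((k + (j + 1)).choose k : ℕ) : K) * k.factorial * ((j + 1) * j.factorial) =
        (k + (j + 1)).factorial := by
      exact_mod_cast Nat.add_sub_cancel_left k (j + 1) ▸
        Nat.choose_mul_factorial_mul_factorial (Nat.le_add_right k (j + 1))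
    have hj : (j + 1 : K) ≠ 0 := Nat.cast_add_one_ne_zero j
    simp only [G, Nat.add_sub_add_right, Nat.add_sub_cancel_left, Nat.add_sub_cancel,
      Nat.succ_ne_zero, if_false, Nat.cast_add, Nat.cast_one]
    rw [← hchoose]
    field_simp
  have hsum := sum_powerset_mem_mul (mem_univ (0 : Fin (n + 1))) (fun _ => 1) G
  rw [← sum_congr rfl horbit, powerset_univ, ← sum_perm_eq_sum_orbit, card_univ, Fintype.card_fin,
    Nat.add_sub_cancel, sum_range_succ, sum_congr rfl hterm, ← mul_sum,
    ← sum_posAntidiagonal_succ n fun t s => F t s / s] at hsum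
  simpa only [G, Nat.sub_self, if_true, mul_zero, zero_mul, add_zero] using hsum

theorem sum_factorSum_eq_sum_annularRotate (n : ℕ) (u v : ℕ → K) :
    ∑ g : Equiv.Perm (Fin (n + 1)), factorSum (n + 1) u v g =
      n.factorial * (((n + 1 : ℕ) : K) / 2 * ∑ ts ∈ posAntidiagonal (n + 1),
        factorSum (ts.1 + ts.2) u v (annularRotate ts.1 ts.2) / (ts.1 * ts.2)) := by
  let F : ℕ → ℕ → K := fun t s => factorSum (t + s) u v (annularRotate t s)
  -- Symmetrize: `1/s + 1/t = (t + s)/(ts)`.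
  have hsymm : ∑ ts ∈ posAntidiagonal (n + 1), F ts.1 ts.2 / ts.2 +
      ∑ ts ∈ posAntidiagonal (n + 1), F ts.2 ts.1 / ts.1 =
      ((n + 1 : ℕ) : K) * ∑ ts ∈ posAntidiagonal (n + 1), F ts.1 ts.2 / (ts.1 * ts.2) := by
    rw [← sum_add_distrib, mul_sum]
    refine sum_congr rfl fun ts hts => ?_
    obtain ⟨hsum, ht, hs⟩ := mem_filter.mp hts
    rw [show F ts.2 ts.1 = F ts.1 ts.2 from factorSum_annularRotate_comm _ _ u v,
      ← HasAntidiagonal.mem_antidiagonal.mp hsum]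
    have ht : (ts.1 : K) ≠ 0 := Nat.cast_ne_zero.mpr (by omega)
    have hs : (ts.2 : K) ≠ 0 := Nat.cast_ne_zero.mpr (by omega)
    push_cast
    field_simp
  rw [← sum_posAntidiagonal_swap (n + 1) fun t s => F t s / s] at hsymm
  rw [sum_factorSum_eq_sum_annularRotate_div]
  linear_combination (n.factorial : K) * hsymm / 2

end Annular

/-! ### Minimal factorizations of a long cycle -/

section SwapMul

variable {X : Type*} [DecidableEq X] {σ : Equiv.Perm X} {i j : X}

theorem cycleRel_inv_mul_swap (σ : Equiv.Perm X) (i j : X) :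
    cycleRel (σ⁻¹ * Equiv.swap i j) = cycleRel (Equiv.swap i j * σ) := by
  rw [← Equiv.swap_inv, ← mul_inv_rev, cycleRel_inv, Equiv.swap_inv]

theorem numClasses_swap_mul_of_sameCycle [Finite X] (hij : i ≠ j) (h : σ.SameCycle i j) :
    numClasses (cycleRel (Equiv.swap i j * σ)) = numClasses (cycleRel σ) + 1 := by
  rw [← cycleRel_inv_mul_swap, ← cycleRel_inv σ,
    numClasses_mul_swap_of_sameCycle hij (Equiv.Perm.sameCycle_inv.mpr h)]

theorem numClasses_swap_mul_le [Finite X] (σ : Equiv.Perm X) (i j : X) :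
    numClasses (cycleRel (Equiv.swap i j * σ)) ≤ numClasses (cycleRel σ) + 1 := by
  rw [← cycleRel_inv_mul_swap, ← cycleRel_inv σ]
  exact numClasses_mul_swap_le σ⁻¹ i j

theorem support_swap_apply_mul_ssubset [Fintype X] (h : σ i ≠ i) :
    (Equiv.swap i (σ i) * σ).support ⊂ σ.support := by
  refine ssubset_iff_of_subset (fun x hx => ?_) |>.mpr
    ⟨i, Equiv.Perm.mem_support.mpr h, by simp⟩
  rw [Equiv.Perm.mem_support] at hx ⊢
  intro hfix
  have hxi : x ≠ i := fun e => h (e ▸ hfix)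
  have hxσ : x ≠ σ i := fun e => hxi (σ.injective (hfix.trans e))
  exact hx (by rw [Equiv.Perm.mul_apply, hfix, Equiv.swap_apply_of_ne_of_ne hxi hxσ])

theorem mapsTo_mul_swap {A : Set X} (hA : Set.MapsTo σ A A) (hij : i ∈ A ↔ j ∈ A) :
    Set.MapsTo (σ * Equiv.swap i j) A A := by
  intro x hx
  refine hA ?_
  rcases eq_or_ne x i with rfl | hxi
  · rwa [Equiv.swap_apply_left, ← hij]
  rcases eq_or_ne x j with rfl | hxj
  · rwa [Equiv.swap_apply_right, hij]
  · rwa [Equiv.swap_apply_of_ne_of_ne hxi hxj]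

end SwapMul

section Arcs

variable {n : ℕ} {σ : Equiv.Perm (Fin n)}

/-- The elements met strictly between `a` and `b` on the way around the circle from `a` to `b`.
Unlike `Set.cIoo a a`, which is empty, `openArc a a` is a full turn: all elements except `a`. -/
def openArc (a b : Fin n) : Set (Fin n) :=
  {x | a < x ∧ x < b ∨ b ≤ a ∧ (a < x ∨ x < b)}

theorem mem_openArc {a b x : Fin n} : x ∈ openArc a b ↔
    a.val < x ∧ x.val < b ∨ b.val ≤ a ∧ (a.val < x ∨ x.val < b) := Iff.rfl

theorem left_notMem_openArc {a b : Fin n} : a ∉ openArc a b := by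
  rw [mem_openArc]
  omega

theorem right_notMem_openArc {a b : Fin n} : b ∉ openArc a b := by
  rw [mem_openArc]
  omega

/-- Every open cyclic interval from `i` to `σ i` is stable under `σ`. This characterises the left
factors of the minimal factorizations of the long cycle, see `mem_factors_finRotate_iff`. -/
def ArcStable (σ : Equiv.Perm (Fin n)) : Prop :=
  ∀ i, Set.MapsTo σ (openArc i (σ i)) (openArc i (σ i))

/-- Every cycle of `σ` runs through its elements in increasing cyclic order. -/
def IncreasingCycles (σ : Equiv.Perm (Fin n)) : Prop :=
  ∀ i x, σ.SameCycle i x → x ∉ openArc i (σ i)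

/-- The cycles of `σ` do not cross. -/
def NonCrossingCycles (σ : Equiv.Perm (Fin n)) : Prop :=
  ∀ a b c d, a < b → b < c → c < d → σ.SameCycle a c → σ.SameCycle b d → σ.SameCycle a b

namespace ArcStable

theorem increasingCycles (h : ArcStable σ) : IncreasingCycles σ :=
  fun i _ hix hx => left_notMem_openArc ((mem_iff_of_sameCycle (h i) hix).mpr hx)

theorem nonCrossingCycles (h : ArcStable σ) : NonCrossingCycles σ := by
  classical
  intro a b c d hab hbc hcd hac hbd
  by_contra hn
  obtain ⟨i, hi, hmax⟩ := exists_max_image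
    (univ.filter fun y => σ.SameCycle a y ∧ y < b) id
    ⟨a, mem_filter.mpr ⟨mem_univ _, Equiv.Perm.SameCycle.rfl, hab⟩⟩
  simp only [mem_filter, mem_univ, true_and, id] at hi hmax
  obtain ⟨hai, hib⟩ := hi
  have haσ : σ.SameCycle a (σ i) := Equiv.Perm.sameCycle_apply_right.mpr hai
  have hσb : σ i ≠ b := fun e => hn (e ▸ haσ)
  have hc := h.increasingCycles i c (hai.symm.trans hac)
  have hbd_iff := mem_iff_of_sameCycle (h i) hbd
  have hσ_le : σ i < b → σ i ≤ i := fun hlt => hmax _ ⟨haσ, hlt⟩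
  simp only [mem_openArc, Fin.le_def, Fin.lt_def, Fin.ext_iff, ne_eq] at *
  omega

end ArcStable

theorem arcStable_of_increasing_of_nonCrossing (hinc : IncreasingCycles σ)
    (hnc : NonCrossingCycles σ) : ArcStable σ := by
  intro i x hx_mem
  have hx : σ.SameCycle x (σ x) := cycleRel_apply σ x
  have hi : σ.SameCycle i (σ i) := cycleRel_apply σ i
  have hix : ¬ σ.SameCycle i x := fun h => hinc i x h hx_mem
  have hxi : ¬ σ.SameCycle x i := fun h => hix h.symm
  have hne_left : σ x ≠ i := fun e => hxi (e ▸ hx)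
  have hne_right : σ x ≠ σ i := fun e => hix (hi.trans (e ▸ hx.symm))
  have hnc₁ : ¬ (σ x < i ∧ i < x ∧ x < σ i) := fun h =>
    hxi (hx.trans (hnc _ _ _ _ h.1 h.2.1 h.2.2 hx.symm hi))
  have hnc₂ : ¬ (i < x ∧ x < σ i ∧ σ i < σ x) := fun h =>
    hix (hnc _ _ _ _ h.1 h.2.1 h.2.2 hi hx)
  have hnc₃ : ¬ (x < σ i ∧ σ i < σ x ∧ σ x < i) := fun h =>
    hxi ((hnc _ _ _ _ h.1 h.2.1 h.2.2 hx hi.symm).trans hi.symm)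
  have hnc₄ : ¬ (σ i < σ x ∧ σ x < i ∧ i < x) := fun h =>
    hix (hi.trans ((hnc _ _ _ _ h.1 h.2.1 h.2.2 hi.symm hx.symm).trans hx.symm))
  simp only [mem_openArc, Fin.lt_def, Fin.ext_iff, ne_eq] at *
  omega

end Arcs

section LongCycle

variable {m : ℕ} {σ : Equiv.Perm (Fin (m + 1))}

theorem val_finRotate (x : Fin (m + 1)) :
    (x.val = m ∧ (finRotate (m + 1) x).val = 0) ∨
      (x.val < m ∧ (finRotate (m + 1) x).val = x.val + 1) := by
  rw [coe_finRotate]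
  split_ifs with h
  · exact Or.inl ⟨by rw [h, Fin.val_last], rfl⟩
  · exact Or.inr ⟨Fin.val_lt_last h, rfl⟩

theorem cycleRel_finRotate : cycleRel (finRotate (m + 1)) = ⊤ := by
  have rel_zero (x : Fin (m + 1)) : cycleRel (finRotate (m + 1)) 0 x := by
    induction x using Fin.induction with
    | zero => exact Setoid.refl' _ _
    | succ x ih =>
      have := cycleRel_apply (finRotate (m + 1)) x.castSucc
      rw [finRotate_apply, Fin.coeSucc_eq_succ] at this
      exact Setoid.trans' _ ih this
  exact top_le_iff.mp fun x y _ => Setoid.trans' _ (Setoid.symm' _ (rel_zero x)) (rel_zero y)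

theorem mapsTo_swap_mul_finRotate {a b : Fin (m + 1)} (hab : a ≠ b) :
    Set.MapsTo (Equiv.swap a b * finRotate (m + 1))
      (insert a (openArc a b)) (insert a (openArc a b)) := by
  intro x hx
  have hx' : finRotate (m + 1) x = b ∨ finRotate (m + 1) x ∈ openArc a b := by
    have := val_finRotate x
    simp only [Set.mem_insert_iff, mem_openArc, Fin.ext_iff, ne_eq] at hab hx ⊢
    omega
  rw [Equiv.Perm.mul_apply]
  rcases hx' with h | h
  · rw [h, Equiv.swap_apply_right]
    exact Set.mem_insert _ _
  · rw [Equiv.swap_apply_of_ne_of_ne (ne_of_mem_of_not_mem h left_notMem_openArc)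
      (ne_of_mem_of_not_mem h right_notMem_openArc)]
    exact Or.inr h

theorem cycleRel_swap_mul_le (h : σ ∈ factors (m + 2) (finRotate (m + 1))) {i : Fin (m + 1)}
    (hi : i ≠ σ i) : cycleRel (Equiv.swap i (σ i) * σ) ≤
      cycleRel (Equiv.swap i (σ i) * finRotate (m + 1)) := by
  obtain ⟨-, hcard⟩ := mem_factors.mp h
  set τ := Equiv.swap i (σ i)
  set κ := σ⁻¹ * finRotate (m + 1)
  have hmul : τ * σ * κ = τ * finRotate (m + 1) := by
    rw [mul_assoc, mul_inv_cancel_left]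
  have hσ : numClasses (cycleRel (τ * σ)) = numClasses (cycleRel σ) + 1 :=
    numClasses_swap_mul_of_sameCycle hi (cycleRel_apply σ i)
  have hrotate : numClasses (cycleRel (τ * finRotate (m + 1))) = 2 := by
    rw [numClasses_swap_mul_of_sameCycle hi
      (show cycleRel (finRotate (m + 1)) i (σ i) by rw [cycleRel_finRotate]; trivial),
      cycleRel_finRotate, numClasses_top]
  have hgenus := numClasses_add_numClasses_mul_le (τ * σ) κ
  rw [hmul, hσ, hrotate, Nat.card_fin] at hgenus
  have hle : cycleRel (τ * finRotate (m + 1)) ≤ cycleRel (τ * σ) ⊔ cycleRel κ :=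
    hmul ▸ cycleRel_mul_le le_sup_left le_sup_right
  rw [eq_of_numClasses_le hle (by omega)]
  exact le_sup_left

theorem arcStable_of_mem_factors (h : σ ∈ factors (m + 2) (finRotate (m + 1))) :
    ArcStable σ := by
  intro i x hx
  have hσx : σ x ≠ σ i := σ.injective.ne (ne_of_mem_of_not_mem hx left_notMem_openArc)
  rcases eq_or_ne i (σ i) with hi | hi
  · rw [← hi] at hσx ⊢
    rw [mem_openArc]
    omega
  have hmem : Equiv.swap i (σ i) (σ x) ∈ insert i (openArc i (σ i)) :=
    (mem_iff_of_sameCycle (mapsTo_swap_mul_finRotate hi)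
      (cycleRel_swap_mul_le h hi (cycleRel_apply _ x))).mp (Or.inr hx)
  rcases eq_or_ne (σ x) i with hxi | hxi
  · rw [hxi, Equiv.swap_apply_left] at hmem
    exact (right_notMem_openArc (hmem.resolve_left hi.symm)).elim
  · rw [Equiv.swap_apply_of_ne_of_ne hxi hσx] at hmem
    exact hmem.resolve_left hxi

namespace ArcStable

theorem mul_swap (h : ArcStable σ) {j k : Fin (m + 1)} (hjk : j ≠ k)
    (hk : σ k = finRotate (m + 1) j) : ArcStable (σ * Equiv.swap j k) := by
  have hrotate := val_finRotate j
  rw [← hk] at hrotate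
  intro i
  rcases eq_or_ne i j with rfl | hij
  · have hempty : openArc i (σ k) = ∅ := Set.eq_empty_iff_forall_notMem.mpr fun x => by
      simp only [mem_openArc]
      omega
    rw [Equiv.Perm.mul_apply, Equiv.swap_apply_left, hempty]
    exact Set.mapsTo_empty _ _
  have hσ_ne := σ.injective.ne hij
  rcases eq_or_ne i k with rfl | hik
  · have hinter : openArc i (σ j) = openArc j (σ j) ∩ openArc i (σ i) := by
      have hi := h i (x := j)
      have hj := h j (x := i)
      ext x
      simp only [Set.mem_inter_iff, mem_openArc, Fin.ext_iff, ne_eq] at hσ_ne hij hi hj ⊢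
      omega
    rw [Equiv.Perm.mul_apply, Equiv.swap_apply_right, hinter]
    refine mapsTo_mul_swap ((h j).inter_inter (h i)) 
      ⟨fun hj => (left_notMem_openArc hj.1).elim, fun hi => (left_notMem_openArc hi.2).elim⟩
  · rw [Equiv.Perm.mul_apply, Equiv.swap_apply_of_ne_of_ne hij hik]
    refine mapsTo_mul_swap (h i) ?_
    have hk_iff := mem_iff_of_sameCycle (h i) (cycleRel_apply σ k)
    have hσ_ne' := σ.injective.ne hik
    rw [hk_iff]
    simp only [mem_openArc, Fin.ext_iff, ne_eq] at *
    omega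

theorem not_sameCycle (h : ArcStable σ) {j k : Fin (m + 1)} (hjk : j ≠ k)
    (hk : σ k = finRotate (m + 1) j) : ¬ σ.SameCycle j k := by
  intro hs
  have hj := h.increasingCycles k j hs.symm
  have hrotate := val_finRotate j
  rw [← hk] at hrotate
  simp only [mem_openArc, Fin.ext_iff, ne_eq] at *
  omega

theorem le_numClasses (h : ArcStable σ) : m + 2 ≤
    numClasses (cycleRel σ) + numClasses (cycleRel (σ⁻¹ * finRotate (m + 1))) := by
  induction hc : #(σ⁻¹ * finRotate (m + 1)).support using Nat.strong_induction_on
    generalizing σ with | _ c ih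
  set κ := σ⁻¹ * finRotate (m + 1)
  by_cases hone : κ = 1
  · rw [inv_mul_eq_one.mp hone, hone, cycleRel_one, numClasses_bot, cycleRel_finRotate,
      numClasses_top, Nat.card_fin]
    omega
  obtain ⟨j, hj⟩ : ∃ j, κ j ≠ j := by
    by_contra! hall
    exact hone (Equiv.ext hall)
  have hk : σ (κ j) = finRotate (m + 1) j := by
    rw [← Equiv.Perm.mul_apply, mul_inv_cancel_left]
  have hmul : (σ * Equiv.swap j (κ j))⁻¹ * finRotate (m + 1) = Equiv.swap j (κ j) * κ := by
    rw [mul_inv_rev, Equiv.swap_inv, mul_assoc]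
  have hsupp : #(Equiv.swap j (κ j) * κ).support < c :=
    hc ▸ card_lt_card (support_swap_apply_mul_ssubset hj)
  have hind := ih _ (hmul ▸ hsupp) (h.mul_swap hj.symm hk) rfl
  have hσ := numClasses_mul_swap_of_not_sameCycle (h.not_sameCycle hj.symm hk)
  have hκ_le := numClasses_swap_mul_le κ j (κ j)
  rw [hmul] at hind
  omega

end ArcStable

theorem mem_factors_finRotate_iff :
    σ ∈ factors (m + 2) (finRotate (m + 1)) ↔ ArcStable σ := by
  refine ⟨arcStable_of_mem_factors, fun h => mem_factors.mpr ⟨?_, le_antisymm ?_ h.le_numClasses⟩⟩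
  · rw [cycleRel_finRotate, sup_top_eq]
  · have hgenus := numClasses_add_numClasses_mul_le σ (σ⁻¹ * finRotate (m + 1))
    rw [← cycleRel_sup_mul_left, mul_inv_cancel_left, cycleRel_finRotate, sup_top_eq,
      numClasses_top, Nat.card_fin] at hgenus
    omega

end LongCycle

/-! ### Non-crossing partitions and Kreweras complements -/

section Parts

variable {M X : Type*} [CommMonoid M] [Fintype X] [DecidableEq X]
  {π ρ : Finpartition (univ : Finset X)} {r : Setoid X}

theorem finpartition_ext_part (h : ∀ x, π.part x = ρ.part x) : π = ρ := by
  have hparts (π : Finpartition (univ : Finset X)) : π.parts = univ.image π.part := by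
    rw [← coe_inj, coe_image, π.part_surjOn.image_eq_of_mapsTo fun x hx => π.part_mem.mpr hx]
  exact Finpartition.ext (by rw [hparts, hparts, funext h])

theorem exists_quotient_equiv_parts (h : ∀ x y, r x y ↔ y ∈ π.part x) :
    ∃ e : Quotient r ≃ π.parts, ∀ q, #(e q).1 = Nat.card {x // ⟦x⟧ = q} := by
  have hpart (x y : X) : r x y ↔ π.part x = π.part y := by
    rw [h, π.mem_part_iff_part_eq_part (mem_univ y) (mem_univ x), eq_comm]
  let f : Quotient r → π.parts :=
    Quotient.lift (fun x => ⟨π.part x, π.part_mem.mpr (mem_univ x)⟩)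
      fun x y hxy => Subtype.ext ((hpart x y).mp hxy)
  have hf : Function.Bijective f := by
    refine ⟨Quotient.ind₂ fun x y hxy =>
      Quotient.sound ((hpart x y).mpr (congrArg Subtype.val hxy)), fun V => ?_⟩
    obtain ⟨x, -, hx⟩ := π.part_surjOn V.2
    exact ⟨⟦x⟧, Subtype.ext hx⟩
  refine ⟨Equiv.ofBijective f hf, Quotient.ind fun x => ?_⟩
  have hclass (y : X) : y ∈ π.part x ↔ (⟦y⟧ : Quotient r) = ⟦x⟧ := by
    rw [← h, Quotient.eq, r.comm']
  exact (Nat.subtype_card _ hclass).symm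

theorem prod_parts_eq_classProd (h : ∀ x y, r x y ↔ y ∈ π.part x) (u : ℕ → M) :
    ∏ V ∈ π.parts, u #V = classProd u r := by
  obtain ⟨e, he⟩ := exists_quotient_equiv_parts h
  rw [← prod_coe_sort, classProd, ← finprod_eq_prod_of_fintype]
  exact (finprod_eq_of_bijective e e.bijective fun q => by rw [he]).symm

theorem card_parts_eq_numClasses (h : ∀ x y, r x y ↔ y ∈ π.part x) :
    #π.parts = numClasses r := by
  obtain ⟨e, -⟩ := exists_quotient_equiv_parts h
  rw [numClasses, Nat.card_congr e, Nat.card_eq_fintype_card, Fintype.card_coe]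

end Parts

section CyclePartition

variable {n : ℕ} (π : SetPartition n) {σ : Equiv.Perm (Fin n)}

theorem sameCycle_iff_mem_part_cyclePartition {x y : Fin n} :
    σ.SameCycle x y ↔ y ∈ (cyclePartition σ).part x := by
  let : DecidableRel (Equiv.Perm.SameCycle.setoid σ).r :=
    inferInstanceAs (DecidableRel (Equiv.Perm.SameCycle σ))
  exact (Finpartition.mem_part_ofSetoid_iff_rel (s := Equiv.Perm.SameCycle.setoid σ)).symm

theorem blockProd_cyclePartition (u : ℕ → ℝ) (σ : Equiv.Perm (Fin n)) :
    blockProd u (cyclePartition σ) = classProd u (cycleRel σ) :=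
  prod_parts_eq_classProd (fun _ _ => sameCycle_iff_mem_part_cyclePartition) u

theorem card_parts_cyclePartition (σ : Equiv.Perm (Fin n)) :
    #(cyclePartition σ).parts = numClasses (cycleRel σ) :=
  card_parts_eq_numClasses fun _ _ => sameCycle_iff_mem_part_cyclePartition

theorem isCycleOn_blockCycle (V : Finset (Fin n)) : (blockCycle V).IsCycleOn V := by
  have h := (V.sort_nodup (· ≤ ·)).isCycleOn_formPerm
  simp only [mem_sort] at h
  exact h

theorem notMem_openArc_blockCycle {V : Finset (Fin n)} {x y : Fin n} (hx : x ∈ V) (hy : y ∈ V) :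
    y ∉ openArc x (blockCycle V x) := by
  let l := V.sort (· ≤ ·)
  have hlt {a b : ℕ} (ha : a < l.length) (hb : b < l.length) : l[a] < l[b] ↔ a < b :=
    V.sortedLT_sort.strictMono_get.lt_iff_lt (a := ⟨a, ha⟩) (b := ⟨b, hb⟩)
  have hle {a b : ℕ} (ha : a < l.length) (hb : b < l.length) : l[a] ≤ l[b] ↔ a ≤ b :=
    V.sortedLT_sort.strictMono_get.le_iff_le (a := ⟨a, ha⟩) (b := ⟨b, hb⟩)
  obtain ⟨i, hi, rfl⟩ : ∃ i, ∃ hi : i < l.length, l[i] = x :=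
    List.getElem_of_mem ((V.mem_sort (· ≤ ·)).mpr hx)
  obtain ⟨k, hk, rfl⟩ : ∃ k, ∃ hk : k < l.length, l[k] = y :=
    List.getElem_of_mem ((V.mem_sort (· ≤ ·)).mpr hy)
  have hnext : blockCycle V l[i] = l[(i + 1) % l.length]'(Nat.mod_lt _ (i.zero_le.trans_lt hi)) :=
    List.formPerm_apply_getElem l (V.sort_nodup _) i hi
  rw [hnext]
  change ¬ (l[i] < l[k] ∧ l[k] < _ ∨ _ ≤ l[i] ∧ (l[i] < l[k] ∨ l[k] < _))
  rw [hlt, hlt, hle]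
  rcases Nat.lt_or_ge (i + 1) l.length with hlast | hlast
  · have hmod := Nat.mod_eq_of_lt hlast
    omega
  · have hmod : (i + 1) % l.length = 0 := by rw [le_antisymm hi hlast, Nat.mod_self]
    omega

variable {π} in
theorem partitionPerm_apply {V : Finset (Fin n)} (hV : V ∈ π.parts) {x : Fin n} (hx : x ∈ V) :
    partitionPerm π x = blockCycle V x := by
  rw [partitionPerm, ← mul_noncommProd_erase _ hV, Equiv.Perm.mul_apply]
  congr 1
  refine noncommProd_induction _ _ _ (fun f : Equiv.Perm (Fin n) => f x = x)
    (fun f g hf hg => by rw [Equiv.Perm.mul_apply, hg, hf]) rfl fun W hW => ?_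
  obtain ⟨hne, hW⟩ := mem_erase.mp hW
  exact blockCycle_apply_of_notMem (disjoint_left.mp (π.disjoint hV hW hne.symm) hx)

theorem sameCycle_partitionPerm_iff_mem_part {x y : Fin n} :
    (partitionPerm π).SameCycle x y ↔ y ∈ π.part x := by
  have hV := π.part_mem.mpr (mem_univ x)
  have hx := π.mem_part_self.mpr (mem_univ x)
  have hcycle := isCycleOn_blockCycle (π.part x)
  have hmaps : Set.MapsTo (partitionPerm π) (π.part x) (π.part x) := fun z hz => by
    rw [partitionPerm_apply hV hz]
    exact hcycle.1.mapsTo hz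
  have hle : cycleRel (blockCycle (π.part x)) ≤ cycleRel (partitionPerm π) :=
    cycleRel_le_iff.mpr fun z => by
      by_cases hz : z ∈ π.part x
      · rw [← partitionPerm_apply hV hz]
        exact cycleRel_apply _ z
      · rw [blockCycle_apply_of_notMem hz]
  exact ⟨fun h => (mem_iff_of_sameCycle hmaps h).mp hx, fun hy => hle (hcycle.2 hx hy)⟩

theorem cyclePartition_partitionPerm : cyclePartition (partitionPerm π) = π :=
  finpartition_ext_part fun x => ext fun y => by
    rw [← sameCycle_iff_mem_part_cyclePartition, sameCycle_partitionPerm_iff_mem_part]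

theorem increasingCycles_partitionPerm : IncreasingCycles (partitionPerm π) := by
  intro x y hxy
  have hx := π.mem_part_self.mpr (mem_univ x)
  rw [partitionPerm_apply (π.part_mem.mpr (mem_univ x)) hx]
  exact notMem_openArc_blockCycle hx ((sameCycle_partitionPerm_iff_mem_part π).mp hxy)

theorem IncreasingCycles.eq_of_sameCycle_iff {τ : Equiv.Perm (Fin n)} (hσ : IncreasingCycles σ)
    (hτ : IncreasingCycles τ) (h : ∀ x y, σ.SameCycle x y ↔ τ.SameCycle x y) : σ = τ := by
  ext x
  have hσx := hσ x (τ x) ((h _ _).mpr (cycleRel_apply τ x))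
  have hτx := hτ x (σ x) ((h _ _).mp (cycleRel_apply σ x))
  rw [mem_openArc] at hσx hτx
  omega

theorem IncreasingCycles.partitionPerm_cyclePartition (hσ : IncreasingCycles σ) :
    partitionPerm (cyclePartition σ) = σ :=
  (increasingCycles_partitionPerm _).eq_of_sameCycle_iff hσ fun x y => by
    rw [sameCycle_partitionPerm_iff_mem_part, sameCycle_iff_mem_part_cyclePartition]

theorem nonCrossingCycles_partitionPerm_iff :
    NonCrossingCycles (partitionPerm π) ↔ IsNonCrossing π := by
  have hpart {x : Fin n} {V : Finset (Fin n)} (hV : V ∈ π.parts) (hx : x ∈ V) (y : Fin n) :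
      (partitionPerm π).SameCycle x y ↔ y ∈ V := by
    rw [sameCycle_partitionPerm_iff_mem_part, π.part_eq_of_mem hV hx]
  refine ⟨fun h V hV W hW a ha b hb c hc d hd hab hbc hcd => ?_,
    fun h a b c d hab hbc hcd hac hbd => ?_⟩
  · have hab := h a b c d hab hbc hcd ((hpart hV ha c).mpr hc) ((hpart hW hb d).mpr hd)
    exact π.eq_of_mem_parts hV hW ((hpart hV ha b).mp hab) hb
  · obtain ⟨V, hV, ha⟩ := π.exists_mem (mem_univ a)
    obtain ⟨W, hW, hb⟩ := π.exists_mem (mem_univ b)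
    have hVW := h V hV W hW a ha b hb c ((hpart hV ha c).mp hac) d ((hpart hW hb d).mp hbd)
      hab hbc hcd
    exact (hpart hV ha b).mpr (hVW ▸ hb)

theorem blockProd_eq_classProd (u : ℕ → ℝ) :
    blockProd u π = classProd u (cycleRel (partitionPerm π)) :=
  prod_parts_eq_classProd (fun _ _ => sameCycle_partitionPerm_iff_mem_part π) u

end CyclePartition

section Kreweras

variable {m : ℕ}

theorem mem_NC_iff (π : SetPartition (m + 1)) :
    π ∈ NC (m + 1) ↔ partitionPerm π ∈ factors (m + 2) (finRotate (m + 1)) := by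
  rw [NC, mem_filter_univ, mem_factors_finRotate_iff, ← nonCrossingCycles_partitionPerm_iff]
  exact ⟨arcStable_of_increasing_of_nonCrossing (increasingCycles_partitionPerm π),
    ArcStable.nonCrossingCycles⟩

theorem sum_NC_eq_sum_factors (F : Equiv.Perm (Fin (m + 1)) → ℝ) :
    ∑ π ∈ NC (m + 1), F (partitionPerm π) =
      ∑ σ ∈ factors (m + 2) (finRotate (m + 1)), F σ := by
  have hinv {σ : Equiv.Perm (Fin (m + 1))} (hσ : σ ∈ factors (m + 2) (finRotate (m + 1))) :
      partitionPerm (cyclePartition σ) = σ :=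
    (mem_factors_finRotate_iff.mp hσ).increasingCycles.partitionPerm_cyclePartition
  exact sum_bij' (fun π _ => partitionPerm π) (fun σ _ => cyclePartition σ)
    (fun π => (mem_NC_iff π).mp) (fun σ hσ => (mem_NC_iff _).mpr (by rwa [hinv hσ]))
    (fun π _ => cyclePartition_partitionPerm π) (fun σ hσ => hinv hσ) fun _ _ => rfl

/-- The boxed convolution `∑_{π ∈ NC(n)} u_π v_{Kr(π)}` of Nica and Speicher, which multiplies free
cumulants under `⊠`. -/
noncomputable def boxedConv (u v : ℕ → ℝ) (n : ℕ) : ℝ :=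
  ∑ π ∈ NC n, blockProd u π * blockProd v (kreweras π)

theorem factorSum_finRotate (u v : ℕ → ℝ) (m : ℕ) :
    factorSum (m + 2) u v (finRotate (m + 1)) = boxedConv u v (m + 1) := by
  simp only [boxedConv, blockProd_eq_classProd _ u, kreweras, blockProd_cyclePartition]
  exact (sum_NC_eq_sum_factors fun σ =>
    classProd u (cycleRel σ) * classProd v (cycleRel (σ⁻¹ * finRotate (m + 1)))).symm

theorem boxedConv_comm (u v : ℕ → ℝ) (m : ℕ) :
    boxedConv u v (m + 1) = boxedConv v u (m + 1) := by
  rw [← factorSum_finRotate, factorSum_comm, factorSum_finRotate]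

theorem boxedConv_one_left (u : ℕ → ℝ) (m : ℕ) :
    boxedConv (fun _ => 1) u (m + 1) = momentOfCumulant u (m + 1) := by
  rw [boxedConv_comm]
  simp only [boxedConv, blockProd, prod_const_one, mul_one, momentOfCumulant]

end Kreweras

/-! ### Annular non-crossing permutations -/

section Annular

theorem orbitRel_closure_pair {X : Type*} (σ τ : Equiv.Perm X) :
    MulAction.orbitRel (Subgroup.closure {σ, τ}) X = cycleRel σ ⊔ cycleRel τ := by
  refine le_antisymm ?_ (sup_le ?_ ?_)
  · have hle : ∀ g ∈ Subgroup.closure {σ, τ}, cycleRel g ≤ cycleRel σ ⊔ cycleRel τ := by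
      intro g hg
      induction hg using Subgroup.closure_induction with
      | mem g hg => rcases hg with rfl | rfl; exacts [le_sup_left, le_sup_right]
      | one => exact cycleRel_one.trans_le bot_le
      | mul a b _ _ ha hb => exact cycleRel_mul_le ha hb
      | inv a _ ha => rwa [cycleRel_inv]
    rintro _ y ⟨⟨g, hg⟩, rfl⟩
    exact Setoid.symm' _ (hle g hg (cycleRel_apply g y))
  · exact cycleRel_le_iff.mpr fun x =>
      Setoid.symm' _ ⟨⟨σ, Subgroup.subset_closure (Set.mem_insert _ _)⟩, rfl⟩
  · exact cycleRel_le_iff.mpr fun x =>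
      Setoid.symm' _ ⟨⟨τ, Subgroup.subset_closure (Set.mem_insert_of_mem _ rfl)⟩, rfl⟩

theorem isPretransitive_closure_pair_iff {X : Type*} (σ τ : Equiv.Perm X) :
    MulAction.IsPretransitive (Subgroup.closure {σ, τ}) X ↔ cycleRel σ ⊔ cycleRel τ = ⊤ := by
  rw [MulAction.pretransitive_iff_subsingleton_quotient, MulAction.orbitRel.Quotient,
    Quotient.subsingleton_iff, orbitRel_closure_pair]

theorem annularNC_eq_factors (t s : ℕ) : annularNC t s = factors (t + s) (annularRotate t s) := by
  classical
  ext σ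
  rw [annularNC, mem_filter_univ, mem_factors, isPretransitive_closure_pair_iff,
    card_parts_cyclePartition, card_parts_cyclePartition, annularKreweras]

theorem factorSum_annularRotate (t s : ℕ) (u v : ℕ → ℝ) :
    factorSum (t + s) u v (annularRotate t s) = ∑ σ ∈ annularNC t s,
      blockProd u (cyclePartition σ) * blockProd v (cyclePartition (annularKreweras σ)) := by
  simp only [factorSum, annularNC_eq_factors, blockProd_cyclePartition, annularKreweras]

end Annular

/-! ### First-order expansions in `1/d` -/

/-- The expansion `f d = a + b / d + o(1 / d)`, encoded as convergence of the rescaled error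
(see `hasExpansion_iff_isLittleO`). -/
def HasExpansion (f : ℕ → ℝ) (a b : ℝ) : Prop :=
  Tendsto (fun d : ℕ => (d : ℝ) * (f d - a)) atTop (𝓝 b)

section HasExpansion

variable {f g : ℕ → ℝ} {a b a' b' : ℝ}

theorem eventually_natCast_ne_zero : ∀ᶠ d : ℕ in atTop, (d : ℝ) ≠ 0 :=
  (eventually_ne_atTop 0).mono fun _ => Nat.cast_ne_zero.mpr

theorem hasExpansion_iff_isLittleO : HasExpansion f a b ↔
    (fun d : ℕ => f d - (a + b / d)) =o[atTop] (fun d : ℕ => 1 / (d : ℝ)) := by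
  rw [isLittleO_iff_tendsto' (eventually_natCast_ne_zero.mono fun d hd h0 =>
    absurd h0 (one_div_ne_zero hd)), HasExpansion, ← tendsto_sub_nhds_zero_iff]
  refine tendsto_congr' (eventually_natCast_ne_zero.mono fun d hd => ?_)
  field_simp
  ring

theorem HasExpansion.tendsto (h : HasExpansion f a b) : Tendsto f atTop (𝓝 a) := by
  have hlim := (Tendsto.mul h tendsto_one_div_atTop_nhds_zero_nat).add_const a
  rw [mul_zero, zero_add] at hlim
  refine hlim.congr' (eventually_natCast_ne_zero.mono fun d hd => ?_)
  field_simp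
  ring

theorem HasExpansion.congr' (h : HasExpansion f a b) (hfg : f =ᶠ[atTop] g) :
    HasExpansion g a b :=
  Tendsto.congr' (hfg.mono fun d hd => by simp only [hd]) h

theorem hasExpansion_const (c : ℝ) : HasExpansion (fun _ => c) c 0 := by
  simp only [HasExpansion, sub_self, mul_zero, tendsto_const_nhds]

theorem HasExpansion.sub (hf : HasExpansion f a b) (hg : HasExpansion g a' b') :
    HasExpansion (fun d => f d - g d) (a - a') (b - b') :=
  (Tendsto.sub hf hg).congr fun d => by ring

theorem HasExpansion.mul (hf : HasExpansion f a b) (hg : HasExpansion g a' b') :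
    HasExpansion (fun d => f d * g d) (a * a') (b * a' + a * b') :=
  ((Tendsto.mul hf hg.tendsto).add (Tendsto.const_mul a hg)).congr fun d => by ring

theorem HasExpansion.div (hf : HasExpansion f a b) (hg : HasExpansion g a' b') (h : a' ≠ 0) :
    HasExpansion (fun d => f d / g d) (a / a') ((b * a' - a * b') / (a' * a')) := by
  refine (((Tendsto.mul hf tendsto_const_nhds).sub (Tendsto.const_mul a hg)).div
    (hg.tendsto.mul_const a') (mul_ne_zero h h)).congr' ?_
  filter_upwards [hg.tendsto.eventually_ne h] with d hd
  simp only [Pi.div_apply]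
  field_simp
  ring

theorem HasExpansion.sum {ι : Type*} {s : Finset ι} {F : ι → ℕ → ℝ} {A B : ι → ℝ}
    (h : ∀ i ∈ s, HasExpansion (F i) (A i) (B i)) :
    HasExpansion (fun d => ∑ i ∈ s, F i d) (∑ i ∈ s, A i) (∑ i ∈ s, B i) :=
  (tendsto_finsetSum s h).congr fun d => by rw [← mul_sum, ← sum_sub_distrib]

theorem HasExpansion.prod {ι : Type*} [DecidableEq ι] {s : Finset ι} {F : ι → ℕ → ℝ} {A B : ι → ℝ}
    (h : ∀ i ∈ s, HasExpansion (F i) (A i) (B i)) :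
    HasExpansion (fun d => ∏ i ∈ s, F i d) (∏ i ∈ s, A i)
      (∑ i ∈ s, B i * ∏ j ∈ s.erase i, A j) := by
  induction s using Finset.induction_on with
  | empty => simpa only [prod_empty, sum_empty] using hasExpansion_const 1
  | insert x s hx ih =>
    have hmul := (h x (mem_insert_self x s)).mul (ih fun i hi => h i (mem_insert_of_mem hi))
    simp only [prod_insert hx]
    convert hmul using 1
    rw [sum_insert hx, erase_insert hx, mul_sum]
    congr 1
    refine sum_congr rfl fun i hi => ?_
    rw [erase_insert_of_ne (ne_of_mem_of_not_mem hi hx).symm,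
      prod_insert fun h => hx (mem_of_mem_erase h), mul_left_comm]

end HasExpansion

/-! ### Expansion of the genus sum -/

/-- The coefficient of `-ε` in `genusSum n ε u v`. -/
noncomputable def annularSum (n : ℕ) (u v : ℕ → ℝ) : ℝ :=
  (n : ℝ) / 2 * ∑ ts ∈ posAntidiagonal n, ∑ σ ∈ annularNC ts.1 ts.2,
    blockProd u (cyclePartition σ) * blockProd v (cyclePartition (annularKreweras σ)) /
      ((ts.1 : ℝ) * (ts.2 : ℝ))

/-- The terms of order at least two in `genusSum n ε u v`, divided by `ε ^ 2`. -/
noncomputable def genusTail (n : ℕ) (ε : ℝ) (u v : ℕ → ℝ) : ℝ :=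
  1 / ((n - 1).factorial : ℝ) * ∑ a ∈ transitivePairs (Fin n) with
      2 ≤ n + 1 - numClasses (cycleRel a.1) - numClasses (cycleRel a.2),
    (-ε) ^ (n + 1 - numClasses (cycleRel a.1) - numClasses (cycleRel a.2) - 2) *
      (classProd u (cycleRel a.1) * classProd v (cycleRel a.2))

theorem sum_pow_mul_eq {ι R : Type*} [CommSemiring R] (s : Finset ι) (x : R) (e : ι → ℕ)
    (F : ι → R) :
    ∑ i ∈ s, x ^ e i * F i = ∑ i ∈ s with e i = 0, F i + x * ∑ i ∈ s with e i = 1, F i +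
      x ^ 2 * ∑ i ∈ s with 2 ≤ e i, x ^ (e i - 2) * F i := by
  rw [mul_sum, mul_sum, sum_filter, sum_filter, sum_filter, ← sum_add_distrib, ← sum_add_distrib]
  refine sum_congr rfl fun i _ => ?_
  rcases e i with _ | _ | k
  · simp
  · simp
  · rw [if_neg (by omega), if_neg (by omega), if_pos (by omega), show k + 1 + 1 - 2 = k from rfl]
    ring

theorem boxedConv_eq_sum_transitivePairs (n : ℕ) (u v : ℕ → ℝ) :
    boxedConv u v (n + 1) = 1 / (n.factorial : ℝ) * ∑ a ∈ transitivePairs (Fin (n + 1)) with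
        numClasses (cycleRel a.1) + numClasses (cycleRel a.2) = n + 2,
      classProd u (cycleRel a.1) * classProd v (cycleRel a.2) := by
  rw [sum_transitivePairs_eq_sum_factorSum, sum_factorSum_eq_factorial_mul, ← mul_assoc,
    one_div_mul_cancel (Nat.cast_ne_zero.mpr n.factorial_ne_zero), one_mul, factorSum_finRotate]

theorem annularSum_eq_sum_transitivePairs (n : ℕ) (u v : ℕ → ℝ) :
    annularSum (n + 1) u v = 1 / (n.factorial : ℝ) * ∑ a ∈ transitivePairs (Fin (n + 1)) with
        numClasses (cycleRel a.1) + numClasses (cycleRel a.2) = n + 1,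
      classProd u (cycleRel a.1) * classProd v (cycleRel a.2) := by
  rw [sum_transitivePairs_eq_sum_factorSum, sum_factorSum_eq_sum_annularRotate, ← mul_assoc,
    one_div_mul_cancel (Nat.cast_ne_zero.mpr n.factorial_ne_zero), one_mul, annularSum]
  simp only [factorSum_annularRotate, sum_div]

theorem genusSum_eq (n : ℕ) (ε : ℝ) (u v : ℕ → ℝ) :
    genusSum (n + 1) ε u v = boxedConv u v (n + 1) - ε * annularSum (n + 1) u v +
      ε ^ 2 * genusTail (n + 1) ε u v := by
  have hexponent {k i : ℕ} (hk : k ≤ 1) (hi : i + k = n + 2) :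
      {a ∈ transitivePairs (Fin (n + 1)) |
        n + 1 + 1 - numClasses (cycleRel a.1) - numClasses (cycleRel a.2) = k} =
      {a ∈ transitivePairs (Fin (n + 1)) |
        numClasses (cycleRel a.1) + numClasses (cycleRel a.2) = i} := by
    refine filter_congr fun a ha => ?_
    have hle := numClasses_add_le_of_mem_transitivePairs ha
    rw [Fintype.card_fin] at hle
    omega
  rw [genusSum, genusTail, sum_pow_mul_eq, hexponent (i := n + 2) zero_le_one rfl,
    hexponent (i := n + 1) le_rfl rfl, boxedConv_eq_sum_transitivePairs,
    annularSum_eq_sum_transitivePairs, Nat.add_sub_cancel]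
  ring

section Limits

variable {U V : ℕ → ℕ → ℝ} {u v u' v' : ℕ → ℝ}

theorem tendsto_classProd {X : Type*} [Finite X]
    (hU : ∀ k, 1 ≤ k → Tendsto (fun d => U d k) atTop (𝓝 (u k))) (r : Setoid X) :
    Tendsto (fun d => classProd (U d) r) atTop (𝓝 (classProd u r)) := by
  cases nonempty_fintype (Quotient r)
  simp only [classProd, finprod_eq_prod_of_fintype]
  refine tendsto_finsetProd _ fun q _ => hU _ ?_
  obtain ⟨x, hx⟩ := q.exists_rep
  have : Nonempty {y // (⟦y⟧ : Quotient r) = q} := ⟨x, hx⟩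
  exact Nat.card_pos

theorem tendsto_blockProd {n : ℕ} (hU : ∀ k, 1 ≤ k → Tendsto (fun d => U d k) atTop (𝓝 (u k)))
    (π : SetPartition n) : Tendsto (fun d => blockProd (U d) π) atTop (𝓝 (blockProd u π)) :=
  tendsto_finsetProd _ fun _ hW => hU _ (card_pos.mpr (π.nonempty_of_mem_parts hW))

theorem hasExpansion_blockProd {n : ℕ}
    (hU : ∀ k, 1 ≤ k → HasExpansion (fun d => U d k) (u k) (u' k)) (π : SetPartition n) :
    HasExpansion (fun d => blockProd (U d) π) (blockProd u π) (blockDerivSum u' u π) :=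
  HasExpansion.prod fun _ hW => hU _ (card_pos.mpr (π.nonempty_of_mem_parts hW))

theorem hasExpansion_boxedConv (n : ℕ)
    (hU : ∀ k, 1 ≤ k → HasExpansion (fun d => U d k) (u k) (u' k))
    (hV : ∀ k, 1 ≤ k → HasExpansion (fun d => V d k) (v k) (v' k)) :
    HasExpansion (fun d => boxedConv (U d) (V d) n) (boxedConv u v n)
      (∑ π ∈ NC n, (blockDerivSum u' u π * blockProd v (kreweras π) +
        blockProd u π * blockDerivSum v' v (kreweras π))) :=
  HasExpansion.sum fun π _ => (hasExpansion_blockProd hU π).mul (hasExpansion_blockProd hV _)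

theorem tendsto_annularSum (n : ℕ)
    (hU : ∀ k, 1 ≤ k → Tendsto (fun d => U d k) atTop (𝓝 (u k)))
    (hV : ∀ k, 1 ≤ k → Tendsto (fun d => V d k) atTop (𝓝 (v k))) :
    Tendsto (fun d => annularSum n (U d) (V d)) atTop (𝓝 (annularSum n u v)) :=
  Tendsto.const_mul _ (tendsto_finsetSum _ fun _ _ => tendsto_finsetSum _ fun _ _ =>
    ((tendsto_blockProd hU _).mul (tendsto_blockProd hV _)).div_const _)

theorem tendsto_genusTail (n : ℕ)
    (hU : ∀ k, 1 ≤ k → Tendsto (fun d => U d k) atTop (𝓝 (u k)))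
    (hV : ∀ k, 1 ≤ k → Tendsto (fun d => V d k) atTop (𝓝 (v k))) :
    Tendsto (fun d : ℕ => genusTail n (1 / d) (U d) (V d)) atTop (𝓝 (genusTail n 0 u v)) :=
  Tendsto.const_mul _ (tendsto_finsetSum _ fun _ _ =>
    (tendsto_one_div_atTop_nhds_zero_nat.neg.pow _).mul
      ((tendsto_classProd hU _).mul (tendsto_classProd hV _)))

theorem hasExpansion_genusSum (n : ℕ)
    (hU : ∀ k, 1 ≤ k → HasExpansion (fun d => U d k) (u k) (u' k))
    (hV : ∀ k, 1 ≤ k → HasExpansion (fun d => V d k) (v k) (v' k)) :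
    HasExpansion (fun d : ℕ => genusSum (n + 1) (1 / d) (U d) (V d)) (boxedConv u v (n + 1))
      (mulInfinitesimalMoment u u' v v' (n + 1)) := by
  have hU' := fun k hk => (hU k hk).tendsto
  have hV' := fun k hk => (hV k hk).tendsto
  have hlim := (Tendsto.sub (hasExpansion_boxedConv (n + 1) hU hV)
    (tendsto_annularSum (n + 1) hU' hV')).add
    (tendsto_one_div_atTop_nhds_zero_nat.mul (tendsto_genusTail (n + 1) hU' hV'))
  rw [zero_mul, add_zero] at hlim
  refine hlim.congr' (eventually_natCast_ne_zero.mono fun d hd => ?_)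
  simp only [genusSum_eq]
  field_simp
  ring

end Limits

/-! ### Expansion of the finite free cumulants -/

section Truncation

theorem card_fiber_lt_of_ne_top {X : Type*} [Finite X] {r : Setoid X} (hr : r ≠ ⊤)
    (q : Quotient r) : Nat.card {x // ⟦x⟧ = q} < Nat.card X := by
  obtain ⟨x, hx⟩ : ∃ x, ⟦x⟧ ≠ q := by
    by_contra! h
    exact hr (top_le_iff.mp fun x y _ => Quotient.exact ((h x).trans (h y).symm))
  exact Finite.card_subtype_lt hx

theorem classProd_eq_add_single (n : ℕ) (v : ℕ → ℝ) (r : Setoid (Fin (n + 1))) :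
    classProd v r = classProd ((Set.Iic n).indicator v) r +
      v (n + 1) * classProd (Pi.single (n + 1) 1) r := by
  by_cases hr : r = ⊤
  · rw [hr, classProd_top, classProd_top, classProd_top, Nat.card_fin, Pi.single_eq_same,
      Set.indicator_of_notMem (by simp), zero_add, mul_one]
  cases nonempty_fintype (Quotient r)
  have hlt (q : Quotient r) : Nat.card {x // ⟦x⟧ = q} < n + 1 := by
    simpa only [Nat.card_fin] using card_fiber_lt_of_ne_top hr q
  have hzero : classProd (Pi.single (n + 1) (1 : ℝ)) r = 0 := by
    rw [classProd, finprod_eq_prod_of_fintype]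
    exact prod_eq_zero (mem_univ ⟦0⟧) (Pi.single_eq_of_ne (hlt _).ne _)
  rw [hzero, mul_zero, add_zero]
  exact finprod_congr fun q =>
    (Set.indicator_of_mem (Set.mem_Iic.mpr (Nat.le_of_lt_succ (hlt q))) v).symm

theorem genusSum_eq_add_single (n : ℕ) (ε : ℝ) (u v : ℕ → ℝ) :
    genusSum (n + 1) ε u v = genusSum (n + 1) ε u ((Set.Iic n).indicator v) +
      v (n + 1) * genusSum (n + 1) ε u (Pi.single (n + 1) 1) := by
  simp only [genusSum]
  rw [mul_left_comm, ← mul_add]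
  congr 1
  rw [mul_sum, ← sum_add_distrib]
  refine sum_congr rfl fun a _ => ?_
  rw [classProd_eq_add_single n v]
  ring

theorem momentOfCumulant_eq_add_sum_erase (n : ℕ) (v : ℕ → ℝ) : momentOfCumulant v (n + 1) =
    v (n + 1) + ∑ π ∈ (NC (n + 1)).erase ⊤, blockProd v π := by
  rw [momentOfCumulant, ← add_sum_erase _ _ (top_mem_NC n.succ_pos), blockProd,
    top_parts n.succ_pos, prod_singleton, card_univ, Fintype.card_fin]

theorem momentOfCumulant_single (n : ℕ) :
    momentOfCumulant (Pi.single (n + 1) 1) (n + 1) = 1 := by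
  rw [momentOfCumulant_eq_add_sum_erase, Pi.single_eq_same, sum_eq_zero, add_zero]
  intro π hπ
  obtain ⟨V, hV, -⟩ := π.exists_mem (mem_univ (0 : Fin (n + 1)))
  exact prod_eq_zero hV (Pi.single_eq_of_ne (card_block_lt (ne_of_mem_erase hπ) hV).ne _)

theorem momentOfCumulant_indicator (n : ℕ) (v : ℕ → ℝ) :
    momentOfCumulant ((Set.Iic n).indicator v) (n + 1) =
      momentOfCumulant v (n + 1) - v (n + 1) := by
  rw [momentOfCumulant_eq_add_sum_erase, momentOfCumulant_eq_add_sum_erase, add_sub_cancel_left,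
    Set.indicator_of_notMem (by simp), zero_add]
  exact sum_congr rfl fun π hπ => prod_congr rfl fun V hV => Set.indicator_of_mem
    (Set.mem_Iic.mpr (Nat.le_of_lt_succ (card_block_lt (ne_of_mem_erase hπ) hV))) v

theorem momentOfCumulant_congr {r s : ℕ → ℝ} (h : ∀ n, 1 ≤ n → r n = s n) (n : ℕ) :
    momentOfCumulant r n = momentOfCumulant s n :=
  sum_congr rfl fun π _ => prod_congr rfl fun _ hV =>
    h _ (card_pos.mpr (π.nonempty_of_mem_parts hV))

end Truncation

theorem exists_hasExpansion_finiteFreeCumulant {q : ℕ → ℝ[X]}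
    (hq : ∀ d, 1 ≤ d → (q d).Monic ∧ (q d).natDegree = d) {w w' : ℕ → ℝ}
    (hw : ∀ n, 1 ≤ n → HasExpansion (fun d => rootMoment d (q d) n) (w n) (w' n)) (n : ℕ)
    (hn : 1 ≤ n) :
    ∃ b, HasExpansion (fun d => finiteFreeCumulant d (q d) n) (cumulantOfMoment w n) b := by
  induction n using Nat.strong_induction_on with | _ n ih
  obtain ⟨n, rfl⟩ := Nat.exists_eq_add_of_le' hn
  choose! b hb using ih
  have hlower : ∀ k, 1 ≤ k → HasExpansion
      (fun d => (Set.Iic n).indicator (finiteFreeCumulant d (q d)) k)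
      ((Set.Iic n).indicator (cumulantOfMoment w) k) ((Set.Iic n).indicator b k) := fun k hk => by
    by_cases hkn : k ∈ Set.Iic n
    · simpa only [Set.indicator_of_mem hkn] using hb k (Nat.lt_succ_of_le hkn) hk
    · simpa only [Set.indicator_of_notMem hkn] using hasExpansion_const 0
  have hrest := hasExpansion_genusSum n (fun k _ => hasExpansion_const 1) hlower
  have hcoeff := hasExpansion_genusSum n (V := fun _ => Pi.single (n + 1) 1)
    (fun k _ => hasExpansion_const 1) (fun k _ => hasExpansion_const _)
  rw [boxedConv_one_left, momentOfCumulant_indicator, momentOfCumulant,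
    ← moment_cumulant_formula w hn] at hrest
  rw [boxedConv_one_left, momentOfCumulant_single] at hcoeff
  have hdiv := ((hw (n + 1) hn).sub hrest).div hcoeff one_ne_zero
  rw [sub_sub_cancel, div_one] at hdiv
  refine ⟨_, hdiv.congr' ?_⟩
  filter_upwards [eventually_ge_atTop 1, hcoeff.tendsto.eventually_ne one_ne_zero] with d hd hne
  rw [div_eq_iff hne, rootMoment_eq_genusSum (Nat.one_le_iff_ne_zero.mp hd) (hq d hd).1
    (hq d hd).2, genusSum_eq_add_single, add_sub_cancel_left]

section Main

variable {p q : ℕ → ℝ[X]} {m m' w w' rhat : ℕ → ℝ}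

theorem hasExpansion_rootMoment_finiteFreeMul
    (hp : ∀ d, 1 ≤ d → (p d).Monic ∧ (p d).natDegree = d)
    (hq : ∀ d, 1 ≤ d → (q d).Monic ∧ (q d).natDegree = d)
    (hm : ∀ n, 1 ≤ n → HasExpansion (fun d => rootMoment d (p d) n) (m n) (m' n))
    {r : ℕ → ℝ}
    (hr : ∀ n, 1 ≤ n → HasExpansion (fun d => finiteFreeCumulant d (q d) n) (r n) (rhat n))
    (n : ℕ) :
    HasExpansion (fun d => rootMoment d (finiteFreeMul d (p d) (q d)) (n + 1))
      (boxedConv m r (n + 1)) (mulInfinitesimalMoment m m' r rhat (n + 1)) := by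
  refine (hasExpansion_genusSum n hm hr).congr' ?_
  filter_upwards [eventually_ge_atTop 1] with d hd
  exact (rootMoment_finiteFreeMul (Nat.one_le_iff_ne_zero.mp hd) (hp d hd).1 (hp d hd).2
    (hq d hd).1 (hq d hd).2 n).symm

theorem momentOfCumulant_boxedConv_cumulantOfMoment
    (hp : ∀ d, 1 ≤ d → (p d).Monic ∧ (p d).natDegree = d)
    (hq : ∀ d, 1 ≤ d → (q d).Monic ∧ (q d).natDegree = d)
    (hm : ∀ n, 1 ≤ n → HasExpansion (fun d => rootMoment d (p d) n) (m n) (m' n))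
    {r : ℕ → ℝ}
    (hr : ∀ n, 1 ≤ n → HasExpansion (fun d => finiteFreeCumulant d (q d) n) (r n) (rhat n))
    (n : ℕ) :
    momentOfCumulant (boxedConv (cumulantOfMoment m) r) (n + 1) = boxedConv m r (n + 1) := by
  -- Both sides are the limit of the moments of `p_d ⊠_d q_d`: the left one expresses these through
  -- the cumulants of `p_d ⊠_d q_d`, the right one through the moments of `p_d` and the cumulants
  -- of `q_d`.
  choose! shat hs using exists_hasExpansion_finiteFreeCumulant hp hm
  have hcumulant : ∀ k, 1 ≤ k → HasExpansion
      (fun d => finiteFreeCumulant d (finiteFreeMul d (p d) (q d)) k)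
      (boxedConv (cumulantOfMoment m) r k)
      (mulInfinitesimalMoment (cumulantOfMoment m) shat r rhat k) := fun k hk => by
    obtain ⟨k, rfl⟩ := Nat.exists_eq_add_of_le' hk
    refine (hasExpansion_genusSum k hs hr).congr' ?_
    filter_upwards [eventually_ge_atTop 1] with d hd
    exact (finiteFreeCumulant_finiteFreeMul (Nat.one_le_iff_ne_zero.mp hd) (hp d hd).1
      (hp d hd).2 (hq d hd).1 (hq d hd).2 k).symm
  have hmoment := (hasExpansion_genusSum n (fun k _ => hasExpansion_const 1) hcumulant).tendsto
  rw [boxedConv_one_left] at hmoment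
  refine tendsto_nhds_unique (hmoment.congr' ?_)
    (hasExpansion_rootMoment_finiteFreeMul hp hq hm hr n).tendsto
  filter_upwards [eventually_ge_atTop 1] with d hd
  obtain ⟨hpm, hpd⟩ := hp d hd
  obtain ⟨hqm, hqd⟩ := hq d hd
  exact (rootMoment_eq_genusSum (Nat.one_le_iff_ne_zero.mp hd)
    (monic_finiteFreeMul hpm hpd hqm hqd) (natDegree_finiteFreeMul hpm hpd hqm hqd) n).symm

theorem mainTheorem3_general
    (hp : ∀ d, 1 ≤ d → (p d).Monic ∧ (p d).natDegree = d)
    (hq : ∀ d, 1 ≤ d → (q d).Monic ∧ (q d).natDegree = d)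
    (hm : ∀ n, 1 ≤ n → HasExpansion (fun d => rootMoment d (p d) n) (m n) (m' n))
    (hw : ∀ n, 1 ≤ n → HasExpansion (fun d => rootMoment d (q d) n) (w n) (w' n)) :
    ∃ rhat : ℕ → ℝ,
      (∀ n, 1 ≤ n →
        HasExpansion (fun d => finiteFreeCumulant d (q d) n) (cumulantOfMoment w n) (rhat n)) ∧
      ∀ n, 1 ≤ n → HasExpansion (fun d => rootMoment d (finiteFreeMul d (p d) (q d)) n)
        (momentOfCumulant (boxedConv (cumulantOfMoment m) (cumulantOfMoment w)) n)
        (mulInfinitesimalMoment m m' (cumulantOfMoment w) rhat n) := by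
  choose! rhat hr using exists_hasExpansion_finiteFreeCumulant hq hw
  refine ⟨rhat, hr, fun n hn => ?_⟩
  obtain ⟨n, rfl⟩ := Nat.exists_eq_add_of_le' hn
  rw [momentOfCumulant_boxedConv_cumulantOfMoment hp hq hm hr]
  exact hasExpansion_rootMoment_finiteFreeMul hp hq hm hr n

end Main

theorem moment_eq_freeMulMoment {μ ν ρ : Measure ℝ} (h : IsFreeMulConv μ ν ρ) {n : ℕ}
    (hn : 1 ≤ n) : moment ρ n = freeMulMoment μ ν n :=
  (moment_cumulant_formula (moment ρ) hn).trans (momentOfCumulant_congr h.freeCumulant_eq n)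

end FiniteFree

open FiniteFree in
theorem mainTheorem3
    (p q : ℕ → ℝ[X])
    (hp : ∀ d : ℕ, 1 ≤ d → p d ∈ MonicRealRooted d)
    (hq : ∀ d : ℕ, 1 ≤ d → q d ∈ MonicRealRooted d)
    (μ ν : Measure ℝ) (μ' ν' : ℝ[X] →ₗ[ℝ] ℝ)
    (hμ : HasInfinitesimalDistribution p μ μ')
    (hν : HasInfinitesimalDistribution q ν ν') :
    ∃ rhat : ℕ → ℝ, IsCumulantFluctuation q ν rhat ∧
      ∀ n : ℕ, 1 ≤ n →
        ((fun d : ℕ => rootMoment d (finiteFreeMul d (p d) (q d)) n -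
            (freeMulMoment μ ν n +
              mulInfinitesimalMoment (moment μ) (fun k => μ' (X ^ k)) (freeCumulant ν) rhat n / d))
          =o[atTop] (fun d : ℕ => 1 / (d : ℝ))) ∧
        ∀ ρ : Measure ℝ, IsFreeMulConv μ ν ρ → moment ρ n = freeMulMoment μ ν n := by
  obtain ⟨rhat, hr, hmul⟩ := mainTheorem3_general
    (fun d hd => ⟨(hp d hd).1, (hp d hd).2.1⟩) (fun d hd => ⟨(hq d hd).1, (hq d hd).2.1⟩)
    (fun n _ => hμ.tendsto_infinitesimal n) (fun n _ => hν.tendsto_infinitesimal n)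
  exact ⟨rhat, fun n hn => hasExpansion_iff_isLittleO.mp (hr n hn), fun n hn =>
    ⟨hasExpansion_iff_isLittleO.mp (hmul n hn), fun _ hρ => moment_eq_freeMulMoment hρ hn⟩⟩
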